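/- Let $k\ge2$ be an integer. A positive integer $n$ is called $k$-full if $p^k\mid n$ for every prime $p\mid n$; let $\mathcal S_k$ be the set of all $k$-full integers that are not perfect $k$-th powers. For integers $\ell,m\ge0$ let $$\mathcal A_{\ell,m}^{(k)}:=\left\{n\in\mathbb Z_{\ge1}\ :\ \#\big((n^k,(n+1)^k)\cap\mathcal S_k\big)=\ell,\ \ \#\big(((n+1)^k,(n+2)^k)\cap\mathcal S_k\big)=m\right\}.$$ Let $\Lambda_k$ be the set of all real numbers $(b_1^{k+1}b_2^{k+2}\cdots b_{k-1}^{2k-1})^{1/k}$, where $b_1,\dots,b_{k-1}$ are positive integers such that $b_1\cdots b_{k-1}$ is squarefree and at least $2$. For $r\ge0$ let $$\xi_{k,r}:=\sum_{\substack{\mathcal L\subseteq\Lambda_k\\ \#\mathcal L=r}}\ \prod_{\lambda\in\mathcal L}\frac1\lambda ,$$ so that $\xi_{k,0}=1$. Then each of the sums $\xi_{k,r}$ converges and, for all integers $\ell,m\ge0$, the asymptotic density $$d(\mathcal A_{\ell,m}^{(k)}):=\lim_{x\to\infty}\frac{\#\{n\in\mathcal A_{\ell,m}^{(k)}:n\le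 x\}}{x}$$ exists and is given by the absolutely convergent series $$d(\mathcal A_{\ell,m}^{(k)})=\sum_{n\ge0}(-2)^n\binom{\ell+m+n}{\ell,m,n}\,\xi_{k,\ell+m+n},\qquad \binom{\ell+m+n}{\ell,m,n}=\frac{(\ell+m+n)!}{\ell!\,m!\,n!}.$$ -/

import Mathlib

open Filter Topology

/-- A positive integer `n` is `k`-full if `p ^ k` divides `n` for every prime factor `p` of `n`. -/
def IsKFull (k n : ℕ) : Prop :=
  1 ≤ n ∧ ∀ p : ℕ, p.Prime → p ∣ n → p ^ k ∣ n

/-- The set `S_k` of all `k`-full integers that are not perfect `k`-th powers. -/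
def fullNonPowers (k : ℕ) : Set ℕ :=
  {n | IsKFull k n ∧ ¬ ∃ a : ℕ, n = a ^ k}

/-- The set of positive integers `n` such that `(n^k, (n+1)^k)` contains exactly `l` elements
of `S_k` and `((n+1)^k, (n+2)^k)` contains exactly `m` elements of `S_k`. -/
def intervalSet (k l m : ℕ) : Set ℕ :=
  {n | 1 ≤ n ∧
    (Set.Ioo (n ^ k) ((n + 1) ^ k) ∩ fullNonPowers k).ncard = l ∧
    (Set.Ioo ((n + 1) ^ k) ((n + 2) ^ k) ∩ fullNonPowers k).ncard = m}

/-- The set `A` of positive integers has asymptotic density `d`: the quotient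
`#{n ∈ A : n ≤ x} / x` tends to `d` as the real variable `x` tends to infinity. -/
def HasAsymptoticDensity (A : Set ℕ) (d : ℝ) : Prop :=
  Tendsto (fun x : ℝ => (({n : ℕ | n ∈ A ∧ (n : ℝ) ≤ x}.ncard : ℕ) : ℝ) / x) atTop (𝓝 d)

/-- The set `Λ_k` of the real numbers `(b_1^(k+1) b_2^(k+2) ⋯ b_{k-1}^(2k-1))^(1/k)` with positive
integers `b_1, …, b_{k-1}` whose product is squarefree and at least `2`.
The index `i : Fin (k - 1)` stands for `j = i + 1`. -/
def Lam (k : ℕ) : Set ℝ :=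
  {x | ∃ b : Fin (k - 1) → ℕ, (∀ i, 1 ≤ b i) ∧ 2 ≤ ∏ i, b i ∧ Squarefree (∏ i, b i) ∧
    x = (∏ i, (b i : ℝ) ^ (k + ((i : ℕ) + 1))) ^ (1 / (k : ℝ))}

/-- The term `∏_{λ ∈ L} 1 / λ` attached to a finite subset `L` of `Λ_k` with `r` elements. -/
noncomputable def xiTerm (k r : ℕ) (L : {L : Finset (Lam k) // L.card = r}) : ℝ :=
  ∏ x ∈ L.1, 1 / (x : ℝ)

/-- The `r`-th elementary symmetric sum of the numbers `1 / λ`, `λ ∈ Λ_k`. -/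
noncomputable def xi (k r : ℕ) : ℝ :=
  ∑' L : {L : Finset (Lam k) // L.card = r}, xiTerm k r L

/-! Sorting the primes of an element of `S_k` by the residue mod `k` of their exponents writes it
uniquely as `(a λ)^k` with `a ≥ 1` and `λ ∈ Λ_k`. Since `λ > 2`, a unit interval contains at most
one multiple of `λ`, so the number of elements of `S_k` between `n^k` and `(n+1)^k` is the number of
`λ` having a multiple in `(n, n+1)` (`ncard_Ioo_inter_fullNonPowers`).

Such a multiple exists exactly when `(n+1)/λ` mod 1 lies in the arc `(0, 1/λ)`; for `(n+1, n+2)` the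
arc is `(-1/λ, 0)`. The two arcs are disjoint. The numbers `1/λ` together with `1` are linearly
independent over `ℚ` (`linearIndependent_of_pow_eq`), so by Weyl's theorem the events for the
various `λ` in a finite set `F` are independent, each `λ` hitting the first interval, the second, or
neither with probabilities `1/λ`, `1/λ`, `1 - 2/λ`. Expanding the resulting product
(`sum_powersetCard_prod_eq`) gives the elementary symmetric sums of the `1/λ`.

The passage from `F` to `Λ_k` rests on `∑ 1/λ < ∞` and a bound without error term: at most `N/λ` of
the `n < N` are hit by `λ` (`card_filter_mem_hits_le`). The effect of all `λ ∉ F` is thus at most a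
multiple of the tail of a convergent series, uniformly in large `N`. -/

/-! ### Weyl equidistribution on the torus -/

section

open MeasureTheory

theorem UnitAddTorus.mFourier_add_apply {ι : Type*} [Fintype ι] (h : ι → ℤ)
    (x y : UnitAddTorus ι) :
    UnitAddTorus.mFourier h (x + y) = UnitAddTorus.mFourier h x * UnitAddTorus.mFourier h y := by
  simp [UnitAddTorus.mFourier, fourier_apply, Finset.prod_mul_distrib, AddCircle.toCircle_add]

theorem UnitAddTorus.mFourier_zero_apply {ι : Type*} [Fintype ι] (h : ι → ℤ) :
    UnitAddTorus.mFourier h (0 : UnitAddTorus ι) = 1 := by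
  simp [UnitAddTorus.mFourier]

theorem UnitAddTorus.mFourier_nsmul_apply {ι : Type*} [Fintype ι] (h : ι → ℤ)
    (x : UnitAddTorus ι) (n : ℕ) :
    UnitAddTorus.mFourier h (n • x) = UnitAddTorus.mFourier h x ^ n := by
  induction n with
  | zero => simp [UnitAddTorus.mFourier_zero_apply]
  | succ n ih => rw [succ_nsmul, UnitAddTorus.mFourier_add_apply, ih, pow_succ]

theorem UnitAddTorus.sum_zsmul_eq_zero_of_mFourier_eq_one {ι : Type*} [Fintype ι] (h : ι → ℤ)
    (x : UnitAddTorus ι) (hx : UnitAddTorus.mFourier h x = 1) : ∑ i, h i • x i = 0 := by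
  have key : ∀ s : Finset ι, (AddCircle.toCircle (∑ i ∈ s, h i • x i) : ℂ)
      = ∏ i ∈ s, (AddCircle.toCircle (h i • x i) : ℂ) := by
    classical
    intro s
    induction s using Finset.induction_on with
    | empty => simp
    | insert a s ha ih => rw [Finset.sum_insert ha, Finset.prod_insert ha,
        AddCircle.toCircle_add, Circle.coe_mul, ih]
  apply AddCircle.injective_toCircle (one_ne_zero (α := ℝ))
  apply Circle.coe_injective
  rw [key, AddCircle.toCircle_zero, Circle.coe_one]
  simpa [UnitAddTorus.mFourier, fourier_apply] using hx

instance UnitAddTorus.isProbabilityMeasure_volume {ι : Type*} [Fintype ι] :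
    IsProbabilityMeasure (volume : Measure (UnitAddTorus ι)) := by
  have : IsProbabilityMeasure (volume : Measure UnitAddCircle) := ⟨by simp⟩
  exact inferInstanceAs (IsProbabilityMeasure (Measure.pi fun _ : ι => volume))

/-- A point of the torus whose coordinates, together with `1`, are rationally independent. -/
def UnitAddTorus.IsGeneric {ι : Type*} [Fintype ι] (θ : UnitAddTorus ι) : Prop :=
  ∀ h : ι → ℤ, ∑ i, h i • θ i = 0 → h = 0

/-- Translation by `θ` preserves the integral but multiplies it by the character value at `θ`. -/
theorem UnitAddTorus.integral_mFourier_of_ne_one {ι : Type*} [Fintype ι] (h : ι → ℤ)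
    (θ : UnitAddTorus ι) (hθ : UnitAddTorus.mFourier h θ ≠ 1) :
    ∫ x, UnitAddTorus.mFourier h x = 0 := by
  have h1 : ∫ x, UnitAddTorus.mFourier h (x + θ) = ∫ x, UnitAddTorus.mFourier h x :=
    integral_add_right_eq_self (μ := (volume : Measure (UnitAddTorus ι)))
      (fun x => UnitAddTorus.mFourier h x) θ
  simp_rw [UnitAddTorus.mFourier_add_apply] at h1
  rw [integral_mul_const] at h1
  have h2 : (∫ x, UnitAddTorus.mFourier h x) * (UnitAddTorus.mFourier h θ - 1) = 0 := by
    linear_combination h1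
  exact (mul_eq_zero.1 h2).resolve_right (sub_ne_zero.2 hθ)

theorem UnitAddTorus.norm_mFourier_apply {ι : Type*} [Fintype ι] (h : ι → ℤ)
    (θ : UnitAddTorus ι) : ‖UnitAddTorus.mFourier h θ‖ = 1 := by
  simp only [UnitAddTorus.mFourier, fourier_apply, ContinuousMap.coe_mk, norm_prod]
  exact Finset.prod_eq_one fun i _ => Circle.norm_coe _

/-- For `h ≠ 0` genericity makes this a geometric sum of ratio different from `1`, hence bounded in
`N`. -/
theorem UnitAddTorus.tendsto_average_mFourier {ι : Type*} [Fintype ι] {θ : UnitAddTorus ι}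
    (hθ : θ.IsGeneric) (h : ι → ℤ) :
    Tendsto (fun N : ℕ => (∑ n ∈ Finset.range N, UnitAddTorus.mFourier h (n • θ)) / (N : ℂ)) atTop
      (𝓝 (∫ x, UnitAddTorus.mFourier h x)) := by
  by_cases hh : h = 0
  · subst hh
    simp only [UnitAddTorus.mFourier_zero, ContinuousMap.one_apply, Finset.sum_const,
      Finset.card_range, nsmul_eq_mul, mul_one, integral_const, probReal_univ, one_smul]
    refine tendsto_const_nhds.congr' ?_
    filter_upwards [eventually_ge_atTop 1] with N hN
    rw [div_self]
    exact_mod_cast (by omega : N ≠ 0)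
  · have hz : UnitAddTorus.mFourier h θ ≠ 1 := fun h1 =>
      hh (hθ h (UnitAddTorus.sum_zsmul_eq_zero_of_mFourier_eq_one h θ h1))
    rw [UnitAddTorus.integral_mFourier_of_ne_one h θ hz]
    have hz' : 0 < ‖UnitAddTorus.mFourier h θ - 1‖ := norm_pos_iff.2 (sub_ne_zero.2 hz)
    refine squeeze_zero_norm (a := fun N : ℕ => (2 / ‖UnitAddTorus.mFourier h θ - 1‖) / (N : ℝ)) ?_
      (tendsto_const_nhds.div_atTop tendsto_natCast_atTop_atTop)
    intro N
    simp_rw [UnitAddTorus.mFourier_nsmul_apply]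
    rw [geom_sum_eq hz, norm_div, norm_div, Complex.norm_natCast]
    gcongr
    refine (norm_sub_le _ _).trans ?_
    rw [norm_pow, UnitAddTorus.norm_mFourier_apply]
    norm_num

theorem UnitAddTorus.norm_average_sub_le {ι : Type*} [Fintype ι] (θ : UnitAddTorus ι)
    (f g : C(UnitAddTorus ι, ℂ)) (N : ℕ) :
    ‖(∑ n ∈ Finset.range N, f (n • θ)) / (N : ℂ) - (∑ n ∈ Finset.range N, g (n • θ)) / (N : ℂ)‖
      ≤ ‖f - g‖ := by
  rw [← sub_div, ← Finset.sum_sub_distrib, norm_div, Complex.norm_natCast]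
  refine div_le_of_le_mul₀ (by positivity) (by positivity) ?_
  refine (norm_sum_le _ _).trans ?_
  refine (Finset.sum_le_card_nsmul _ _ ‖f - g‖ fun n _ => ?_).trans_eq ?_
  · exact (f - g).norm_coe_le_norm _
  · simp [mul_comm]

theorem UnitAddTorus.norm_integral_sub_le {ι : Type*} [Fintype ι]
    (f g : C(UnitAddTorus ι, ℂ)) :
    ‖(∫ x, f x) - ∫ x, g x‖ ≤ ‖f - g‖ := by
  have hint : ∀ f : C(UnitAddTorus ι, ℂ), Integrable (fun x => f x) := fun f =>
    f.continuous.integrable_of_hasCompactSupport (HasCompactSupport.of_compactSpace f)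
  rw [← integral_sub (hint f) (hint g)]
  refine (norm_integral_le_of_norm_le_const (C := ‖f - g‖) (ae_of_all _ fun x => ?_)).trans ?_
  · exact (f - g).norm_coe_le_norm x
  · simp

/-- Weyl's equidistribution theorem for continuous test functions. -/
theorem UnitAddTorus.tendsto_average {ι : Type*} [Fintype ι] {θ : UnitAddTorus ι}
    (hθ : θ.IsGeneric) (f : C(UnitAddTorus ι, ℂ)) :
    Tendsto (fun N : ℕ => (∑ n ∈ Finset.range N, f (n • θ)) / (N : ℂ)) atTop
      (𝓝 (∫ x, f x)) := by
  have hint : ∀ f : C(UnitAddTorus ι, ℂ), Integrable (fun x => f x) := fun f =>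
    f.continuous.integrable_of_hasCompactSupport (HasCompactSupport.of_compactSpace f)
  -- Averages and integral are linear, which settles trigonometric polynomials; both are 1-Lipschitz
  -- in the sup norm, so density settles the rest.
  have hspan : ∀ g ∈ Submodule.span ℂ (Set.range (UnitAddTorus.mFourier (d := ι))),
      Tendsto (fun N : ℕ => (∑ n ∈ Finset.range N, g (n • θ)) / (N : ℂ)) atTop
      (𝓝 (∫ x, g x)) := by
    intro g hg
    induction hg using Submodule.span_induction with
    | mem g hg =>
      obtain ⟨h, rfl⟩ := hg
      exact UnitAddTorus.tendsto_average_mFourier hθ h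
    | zero => simp
    | add f g _ _ hf hg =>
      simp only [ContinuousMap.add_apply, Finset.sum_add_distrib, add_div]
      rw [integral_add (hint f) (hint g)]
      exact hf.add hg
    | smul c f _ hf =>
      simp only [ContinuousMap.smul_apply, smul_eq_mul, ← Finset.mul_sum, mul_div_assoc]
      rw [integral_const_mul]
      exact hf.const_mul c
  rw [Metric.tendsto_atTop]
  intro ε hε
  have hf : f ∈ closure (Submodule.span ℂ (Set.range (UnitAddTorus.mFourier (d := ι))) :
      Set C(UnitAddTorus ι, ℂ)) := by
    rw [← Submodule.topologicalClosure_coe, UnitAddTorus.span_mFourier_closure_eq_top]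
    trivial
  obtain ⟨g, hg, hfg⟩ := Metric.mem_closure_iff.1 hf (ε / 3) (by positivity)
  obtain ⟨N₀, hN₀⟩ := Metric.tendsto_atTop.1 (hspan g hg) (ε / 3) (by positivity)
  refine ⟨N₀, fun N hN => ?_⟩
  rw [dist_eq_norm] at hfg
  have h1 := UnitAddTorus.norm_average_sub_le θ f g N
  have h2 := UnitAddTorus.norm_integral_sub_le g f
  have h3 := hN₀ N hN
  rw [norm_sub_rev g f] at h2
  rw [← dist_eq_norm] at h1 h2
  have h4 := dist_triangle4 ((∑ n ∈ Finset.range N, f (n • θ)) / (N : ℂ))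
    ((∑ n ∈ Finset.range N, g (n • θ)) / (N : ℂ)) (∫ x, g x) (∫ x, f x)
  linarith

/-- Weyl's equidistribution theorem for sets with null frontier. -/
theorem UnitAddTorus.tendsto_count {ι : Type*} [Fintype ι] {θ : UnitAddTorus ι}
    (hθ : θ.IsGeneric) {E : Set (UnitAddTorus ι)} (hE : volume (frontier E) = 0)
    (hEm : MeasurableSet E) [DecidablePred fun n : ℕ => n • θ ∈ E] :
    Tendsto (fun N : ℕ => (((Finset.range N).filter fun n => n • θ ∈ E).card : ℝ) / N) atTop
      (𝓝 (volume E).toReal) := by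
  classical
  -- The shift discards `N = 0`, for which the empirical measure would not be a probability measure.
  rw [← tendsto_add_atTop_iff_nat 1]
  let ν : ℕ → Measure (UnitAddTorus ι) := fun N =>
    ∑ n ∈ Finset.range (N + 1), ((N + 1 : ℕ) : ENNReal)⁻¹ • Measure.dirac (n • θ)
  have hν : ∀ N, IsProbabilityMeasure (ν N) := by
    intro N
    constructor
    simp only [ν, Measure.finsetSum_apply, Measure.smul_apply, measure_univ, smul_eq_mul, mul_one,
      Finset.sum_const, Finset.card_range, nsmul_eq_mul]
    exact ENNReal.mul_inv_cancel (by simp) (by simp)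
  let P : ℕ → ProbabilityMeasure (UnitAddTorus ι) := fun N => ⟨ν N, hν N⟩
  let Q : ProbabilityMeasure (UnitAddTorus ι) := ⟨volume, inferInstance⟩
  have hP : Tendsto P atTop (𝓝 Q) := by
    rw [ProbabilityMeasure.tendsto_iff_forall_integral_rclike_tendsto ℂ]
    intro f
    have := (tendsto_add_atTop_iff_nat 1).2 (UnitAddTorus.tendsto_average hθ f.toContinuousMap)
    refine this.congr fun N => ?_
    change _ = ∫ x, f x ∂(ν N)
    rw [integral_finsetSum_measure]
    · simp only [integral_smul_measure, integral_dirac, Finset.sum_div, ENNReal.toReal_inv,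
        ENNReal.toReal_natCast]
      refine Finset.sum_congr rfl fun n _ => ?_
      rw [Complex.real_smul, div_eq_inv_mul]
      simp
    · intro n _
      refine Integrable.smul_measure ?_ (by simp)
      exact integrable_dirac (by simp)
  have h := ProbabilityMeasure.tendsto_measure_of_null_frontier_of_tendsto' hP (E := E) hE
  have h' := (ENNReal.tendsto_toReal (measure_ne_top volume E)).comp h
  refine h'.congr fun N => ?_
  change (ν N E).toReal = _
  simp only [ν, Measure.finsetSum_apply, Measure.smul_apply, smul_eq_mul]
  simp only [Measure.dirac_apply' _ hEm, ← Finset.mul_sum, Set.indicator_apply, Pi.one_apply]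
  rw [Finset.sum_boole, ENNReal.toReal_mul, ENNReal.toReal_inv, ENNReal.toReal_natCast,
    ENNReal.toReal_natCast, div_eq_inv_mul]

/-- Weyl's equidistribution theorem for product sets. -/
theorem UnitAddTorus.tendsto_count_pi {ι : Type*} [Fintype ι] {θ : UnitAddTorus ι}
    (hθ : θ.IsGeneric) {B : ι → Set UnitAddCircle} (hB : ∀ i, volume (frontier (B i)) = 0)
    (hBm : ∀ i, MeasurableSet (B i)) [DecidablePred fun n : ℕ => ∀ i, n • θ i ∈ B i] :
    Tendsto (fun N : ℕ => (((Finset.range N).filter fun n => ∀ i, n • θ i ∈ B i).card : ℝ) / N)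
      atTop (𝓝 (∏ i, (volume (B i)).toReal)) := by
  classical
  have hE : volume (frontier (Set.univ.pi B : Set (UnitAddTorus ι))) = 0 := by
    have hsub : frontier (Set.univ.pi B : Set (UnitAddTorus ι)) ⊆
        ⋃ i, Function.eval i ⁻¹' frontier (B i) := by
      intro x hx
      rw [frontier, closure_pi_set, interior_pi_set Set.finite_univ] at hx
      obtain ⟨h1, h2⟩ := hx
      simp only [Set.mem_pi, not_forall] at h2
      obtain ⟨i, hi, h3⟩ := h2
      exact Set.mem_iUnion.2 ⟨i, h1 i hi, h3⟩
    refine measure_mono_null hsub (measure_iUnion_null fun i => ?_)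
    have : IsProbabilityMeasure (volume : Measure UnitAddCircle) := ⟨by simp⟩
    exact (measurePreserving_eval (fun _ : ι => (volume : Measure UnitAddCircle)) i).measure_preimage
      (isClosed_frontier.measurableSet.nullMeasurableSet) |>.trans (hB i)
  have h := UnitAddTorus.tendsto_count hθ hE (MeasurableSet.univ_pi hBm)
  rw [volume_pi_pi, ENNReal.toReal_prod] at h
  refine h.congr fun N => ?_
  simp [Set.mem_pi]

end

/-! ### Linear independence of real radicals over `ℚ` -/

-- All complex roots of the minimal polynomial `p` are roots of `X ^ k - q`, so they have modulus
-- `α`. Hence `|p(0)| = α ^ deg p`, which makes `α` a root of `X ^ deg p - |p(0)|`, a rational monic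
-- polynomial of the same degree as `p`.
open Polynomial in
theorem minpoly_eq_X_pow_sub_C_of_pow_eq {α : ℝ} (hα : 0 < α) {k : ℕ} (hk : 0 < k) {q : ℚ}
    (h : α ^ k = q) : ∃ (m : ℕ) (c : ℚ), 0 < m ∧ minpoly ℚ α = X ^ m - C c := by
  have hmonic : (X ^ k - C q : ℚ[X]).Monic := monic_X_pow_sub_C q hk.ne'
  have hroot : aeval α (X ^ k - C q : ℚ[X]) = 0 := by simp [h]
  have hint : IsIntegral ℚ α := ⟨_, hmonic, by simpa [aeval_def] using hroot⟩
  have hdvd : minpoly ℚ α ∣ X ^ k - C q := minpoly.dvd ℚ α hroot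
  set p := minpoly ℚ α with hp
  have hpm : p.Monic := minpoly.monic hint
  have hpos : 0 < p.natDegree := minpoly.natDegree_pos hint
  have hsplit : (p.map (algebraMap ℚ ℂ)).Splits := IsAlgClosed.splits _
  have hprod : (p.map (algebraMap ℚ ℂ)).coeff 0 =
      (-1) ^ (p.map (algebraMap ℚ ℂ)).natDegree * (p.map (algebraMap ℚ ℂ)).roots.prod :=
    hsplit.coeff_zero_eq_prod_roots_of_monic (hpm.map _)
  have hnorm : ∀ z ∈ (p.map (algebraMap ℚ ℂ)).roots, ‖z‖ = α := by
    intro z hz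
    have hz' : aeval z p = 0 := by
      have := (mem_roots'.1 hz).2
      rwa [IsRoot, eval_map_algebraMap] at this
    have hz2 : aeval z (X ^ k - C q : ℚ[X]) = 0 := by
      obtain ⟨r, hr⟩ := hdvd
      rw [hr, map_mul, hz', zero_mul]
    have hz3 : z ^ k = q := by simpa [sub_eq_zero] using hz2
    have hz4 : ‖z‖ ^ k = α ^ k := by
      rw [← norm_pow, hz3, h]
      have hq : (0 : ℝ) < q := h ▸ pow_pos hα k
      rw [show ((q : ℚ) : ℂ) = ((q : ℝ) : ℂ) by norm_cast, Complex.norm_real, Real.norm_of_nonneg hq.le]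
    exact (pow_left_inj₀ (norm_nonneg _) hα.le hk.ne').1 hz4
  have hcard : (p.map (algebraMap ℚ ℂ)).roots.card = p.natDegree := by
    rw [← hsplit.natDegree_eq_card_roots, natDegree_map]
  have habs : |((p.coeff 0 : ℚ) : ℝ)| = α ^ p.natDegree := by
    have h1 : ‖(p.map (algebraMap ℚ ℂ)).coeff 0‖ = α ^ p.natDegree := by
      rw [hprod, norm_mul, norm_pow, norm_neg, norm_one, one_pow, one_mul]
      have h2 : ∀ s : Multiset ℂ, (∀ z ∈ s, ‖z‖ = α) → ‖s.prod‖ = α ^ s.card := by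
        intro s
        induction s using Multiset.induction_on with
        | empty => simp
        | cons a s ih =>
          intro hs
          rw [Multiset.prod_cons, norm_mul, Multiset.card_cons, pow_succ',
            hs a (Multiset.mem_cons_self a s),
            ih fun z hz => hs z (Multiset.mem_cons_of_mem hz)]
      rw [h2 _ hnorm, hcard]
    rw [coeff_map] at h1
    rw [← h1, ← Real.norm_eq_abs, ← Complex.norm_real]
    simp
  refine ⟨p.natDegree, |p.coeff 0|, hpos, ?_⟩
  have hd : p ∣ X ^ p.natDegree - C |p.coeff 0| := by
    apply minpoly.dvd
    simp [← habs]
  refine (Polynomial.eq_of_monic_of_dvd_of_natDegree_le (p := p) hpm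
    (monic_X_pow_sub_C _ hpos.ne') hd ?_).symm
  rw [natDegree_X_pow_sub_C]

-- Irrationality forces `m ≥ 2` in the minimal polynomial `X ^ m - c`, whose second coefficient, and
-- with it the trace, then vanishes.
open Polynomial in
theorem trace_eq_zero_of_pow_eq {K : IntermediateField ℚ ℝ} [FiniteDimensional ℚ K] (x : K)
    (hx : 0 < (x : ℝ)) {k : ℕ} (hk : 0 < k) {q : ℚ} (h : (x : ℝ) ^ k = q)
    (hirr : Irrational (x : ℝ)) : Algebra.trace ℚ K x = 0 := by
  obtain ⟨m, c, hm, hmc⟩ := minpoly_eq_X_pow_sub_C_of_pow_eq hx hk h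
  have hmin : minpoly ℚ x = X ^ m - C c := by
    rw [← hmc]
    exact (minpoly.algebraMap_eq (algebraMap K ℝ).injective x).symm
  have hm2 : 2 ≤ m := by
    by_contra hlt
    have hm1 : m = 1 := by omega
    subst hm1
    have h0 : aeval (x : ℝ) (minpoly ℚ (x : ℝ)) = 0 := minpoly.aeval ℚ _
    rw [hmc] at h0
    apply hirr
    refine ⟨c, ?_⟩
    simp [sub_eq_zero] at h0
    exact h0.symm
  rw [trace_eq_finrank_mul_minpoly_nextCoeff, hmin, nextCoeff_of_natDegree_pos
    (by rw [natDegree_X_pow_sub_C]; omega), natDegree_X_pow_sub_C]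
  have h1 : ¬ m = 1 := by omega
  have h2 : ¬ m - 1 = m := by omega
  have h3 : ¬ m - 1 = 0 := by omega
  simp [coeff_X_pow, coeff_C, h2, h3]

/-- Positive real radicals of rational numbers are linearly independent over `ℚ` as soon as their
pairwise ratios are irrational. -/
theorem linearIndependent_of_pow_eq {ι : Type*} [Finite ι] (α : ι → ℝ) (hα : ∀ i, 0 < α i) {k : ℕ}
    (hk : 0 < k) (q : ι → ℚ) (hq : ∀ i, α i ^ k = q i)
    (hirr : ∀ i j, i ≠ j → Irrational (α i / α j)) : LinearIndependent ℚ α := by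
  classical
  have := Fintype.ofFinite ι
  rw [Fintype.linearIndependent_iff]
  intro c hc j
  let K : IntermediateField ℚ ℝ := IntermediateField.adjoin ℚ (Set.range α)
  have hint : ∀ i, IsIntegral ℚ (α i) := fun i =>
    ⟨Polynomial.X ^ k - Polynomial.C (q i), Polynomial.monic_X_pow_sub_C _ hk.ne', by simp [hq i]⟩
  have hfin : FiniteDimensional ℚ K := by
    refine IntermediateField.finiteDimensional_adjoin (S := Set.range α) ?_
    rintro _ ⟨i, rfl⟩
    exact hint i
  let a : ι → K := fun i => ⟨α i, IntermediateField.subset_adjoin ℚ _ ⟨i, rfl⟩⟩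
  -- After division by `α j`, every term except the `j`-th has trace zero, so the trace isolates `c
  -- j`.
  have hsum : ∑ i, c i • (a i / a j) = 0 := by
    apply Subtype.ext
    have : ∑ i, c i • (α i / α j) = 0 := by
      simp_rw [← smul_div_assoc, ← Finset.sum_div]
      rw [hc, zero_div]
    simpa [a] using this
  have htr := congrArg (Algebra.trace ℚ K) hsum
  rw [map_sum, map_zero, Finset.sum_eq_single j] at htr
  · have hone : a j / a j = 1 := div_self (by
      intro h
      exact (hα j).ne' (congrArg Subtype.val h))
    rw [hone, map_smul, ← map_one (algebraMap ℚ K), Algebra.trace_algebraMap] at htr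
    have : (Module.finrank ℚ K : ℚ) ≠ 0 := by
      exact_mod_cast Module.finrank_pos.ne'
    simpa [this] using htr
  · intro i _ hij
    rw [map_smul, trace_eq_zero_of_pow_eq (a i / a j) (q := q i / q j) ?_ hk ?_ ?_, smul_zero]
    · exact div_pos (hα i) (hα j)
    · change (α i / α j) ^ k = _
      rw [div_pow, hq, hq]
      push_cast
      rfl
    · exact hirr i j hij
  · simp

/-! ### Arcs on the circle -/

section

open MeasureTheory

/-- The image in `ℝ / ℤ` of an open interval. -/
def openArc (a b : ℝ) : Set UnitAddCircle :=
  (fun x : ℝ => (x : UnitAddCircle)) '' Set.Ioo a b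

theorem UnitAddCircle.coe_eq_coe_iff {x y : ℝ} :
    (x : UnitAddCircle) = y ↔ ∃ n : ℤ, x = y + n := by
  rw [← sub_eq_zero, ← AddCircle.coe_sub, AddCircle.coe_eq_zero_iff]
  constructor
  · rintro ⟨n, hn⟩
    exact ⟨n, by simp at hn; linarith⟩
  · rintro ⟨n, hn⟩
    exact ⟨n, by simp [hn]⟩

theorem coe_mem_openArc_iff {a b x : ℝ} :
    (x : UnitAddCircle) ∈ openArc a b ↔ ∃ n : ℤ, a < x - n ∧ x - n < b := by
  constructor
  · rintro ⟨y, hy, hxy⟩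
    obtain ⟨n, hn⟩ := UnitAddCircle.coe_eq_coe_iff.1 hxy.symm
    exact ⟨n, by rw [hn]; simpa using hy⟩
  · rintro ⟨n, hn⟩
    exact ⟨x - n, hn, (UnitAddCircle.coe_eq_coe_iff.2 ⟨n, by ring⟩).symm⟩

theorem isOpen_openArc (a b : ℝ) : IsOpen (openArc a b) :=
  QuotientAddGroup.isOpenMap_coe _ isOpen_Ioo

/-- The interval lies in one period, so the projection is injective on it and no translate meets the
fundamental domain. -/
theorem volume_openArc {a b : ℝ} (t : ℝ) (ha : t ≤ a) (hb : b ≤ t + 1) :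
    volume (openArc a b) = ENNReal.ofReal (b - a) := by
  rw [← (UnitAddCircle.measurePreserving_mk t).measure_preimage
    (isOpen_openArc a b).measurableSet.nullMeasurableSet, Measure.restrict_apply
    ((UnitAddCircle.measurePreserving_mk t).measurable (isOpen_openArc a b).measurableSet),
    ← Real.volume_Ioo]
  congr 1
  ext x
  constructor
  · rintro ⟨h1, h2⟩
    obtain ⟨n, hn1, hn2⟩ := coe_mem_openArc_iff.1 h1
    have h3 : ((n : ℤ) : ℝ) < 1 := by linarith [h2.2]
    have h4 : (-1 : ℝ) < n := by linarith [h2.1]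
    have h5 : n < 1 := by exact_mod_cast h3
    have h6 : -1 < n := by exact_mod_cast h4
    obtain rfl : n = 0 := by omega
    simpa using And.intro hn1 hn2
  · intro h
    exact ⟨coe_mem_openArc_iff.2 ⟨0, by simpa using h⟩, ha.trans_lt h.1, h.2.le.trans hb⟩

theorem UnitAddCircle.volume_singleton (x : UnitAddCircle) : volume {x} = 0 := by
  rw [← Metric.closedBall_zero, AddCircle.volume_closedBall]
  simp

theorem volume_frontier_openArc (a b : ℝ) : volume (frontier (openArc a b)) = 0 := by
  have hclosed : closure (openArc a b) ⊆ (fun x : ℝ => (x : UnitAddCircle)) '' Set.Icc a b := by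
    refine closure_minimal (Set.image_mono Set.Ioo_subset_Icc_self) ?_
    exact (isCompact_Icc.image (AddCircle.continuous_mk' 1)).isClosed
  have hsub : frontier (openArc a b) ⊆ {(a : UnitAddCircle)} ∪ {(b : UnitAddCircle)} := by
    intro x hx
    rw [(isOpen_openArc a b).frontier_eq] at hx
    obtain ⟨y, hy, rfl⟩ := hclosed hx.1
    have hy' : y ∉ Set.Ioo a b := fun h => hx.2 ⟨y, h, rfl⟩
    rcases hy.1.eq_or_lt with h | h
    · exact Or.inl (by simp [h])
    · rcases hy.2.eq_or_lt with h' | h'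
      · exact Or.inr (by simp [h'])
      · exact absurd ⟨h, h'⟩ hy'
  exact measure_mono_null hsub (measure_union_null (UnitAddCircle.volume_singleton _)
    (UnitAddCircle.volume_singleton _))

/-- A common point would produce an integer strictly between `0` and `2w ≤ 1`. -/
theorem disjoint_openArc {w : ℝ} (hw : 2 * w ≤ 1) : Disjoint (openArc 0 w) (openArc (-w) 0) := by
  rw [Set.disjoint_left]
  rintro _ ⟨x, hx, rfl⟩ h
  obtain ⟨n, h1, h2⟩ := coe_mem_openArc_iff.1 h
  have h3 : (0 : ℝ) < n := by linarith [hx.1]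
  have h4 : (n : ℝ) < 1 := by linarith [hx.2]
  have h5 : 0 < n := by exact_mod_cast h3
  have h6 : n < 1 := by exact_mod_cast h4
  omega

theorem volume_compl_openArc_union {w : ℝ} (hw0 : 0 ≤ w) (hw : 2 * w ≤ 1) :
    (volume (openArc 0 w ∪ openArc (-w) 0)ᶜ).toReal = 1 - 2 * w := by
  have hm := ((isOpen_openArc 0 w).union (isOpen_openArc (-w) 0)).measurableSet
  have : IsProbabilityMeasure (volume : Measure UnitAddCircle) := ⟨by simp⟩
  rw [← Measure.real, probReal_compl_eq_one_sub hm, Measure.real,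
    measure_union (disjoint_openArc hw) (isOpen_openArc _ _).measurableSet,
    volume_openArc 0 le_rfl (by linarith), volume_openArc (-1) (by linarith) (by norm_num),
    ENNReal.toReal_add (by simp) (by simp), ENNReal.toReal_ofReal (by linarith),
    ENNReal.toReal_ofReal (by linarith)]
  ring

theorem volume_frontier_compl_openArc_union (w : ℝ) :
    volume (frontier (openArc 0 w ∪ openArc (-w) 0)ᶜ) = 0 := by
  rw [frontier_compl]
  refine measure_mono_null (frontier_union_subset _ _) (measure_union_null ?_ ?_)
  · exact measure_mono_null Set.inter_subset_left (volume_frontier_openArc _ _)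
  · exact measure_mono_null Set.inter_subset_right (volume_frontier_openArc _ _)

end

/-! ### Unique representation of the elements of `S_k` -/

/-- The tuples `b` that parametrize `Lam k`. -/
def IsAdmissible {k : ℕ} (b : Fin (k - 1) → ℕ) : Prop :=
  (∀ i, 1 ≤ b i) ∧ 2 ≤ ∏ i, b i ∧ Squarefree (∏ i, b i)

/-- The `k`-th power of the element of `Lam k` that belongs to the tuple `b`. -/
def radicand {k : ℕ} (b : Fin (k - 1) → ℕ) : ℕ :=
  ∏ i, b i ^ (k + ((i : ℕ) + 1))

theorem radicand_pos {k : ℕ} {b : Fin (k - 1) → ℕ} (hb : IsAdmissible b) : 0 < radicand b :=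
  Finset.prod_pos fun i _ => pow_pos (hb.1 i) _

theorem factorization_radicand {k : ℕ} {b : Fin (k - 1) → ℕ} (hb : IsAdmissible b) (p : ℕ) :
    (radicand b).factorization p = ∑ i : Fin (k - 1), (k + ((i : ℕ) + 1)) * (b i).factorization p := by
  rw [radicand, Nat.factorization_prod fun i _ => (pow_pos (hb.1 i) _).ne']
  simp [Nat.factorization_pow]

theorem not_dvd_of_dvd_of_ne {k : ℕ} {b : Fin (k - 1) → ℕ} (hb : IsAdmissible b) {p : ℕ}
    (hp : p.Prime) {i j : Fin (k - 1)} (hij : j ≠ i) (hi : p ∣ b i) : ¬ p ∣ b j := by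
  intro hj
  have h1 : b i * b j ∣ ∏ i, b i := by
    rw [← Finset.mul_prod_erase _ _ (Finset.mem_univ i)]
    exact mul_dvd_mul_left _ (Finset.dvd_prod_of_mem _ (Finset.mem_erase.2 ⟨hij, Finset.mem_univ j⟩))
  exact hp.one_lt.ne' (Nat.isUnit_iff.1 (hb.2.2 p ((mul_dvd_mul hi hj).trans h1)))

theorem factorization_radicand_of_dvd {k : ℕ} {b : Fin (k - 1) → ℕ} (hb : IsAdmissible b) {p : ℕ}
    (hp : p.Prime) {i : Fin (k - 1)} (hi : p ∣ b i) :
    (radicand b).factorization p = k + ((i : ℕ) + 1) := by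
  rw [factorization_radicand hb, Finset.sum_eq_single i]
  · have h1 : Squarefree (b i) := hb.2.2.squarefree_of_dvd (Finset.dvd_prod_of_mem _ (Finset.mem_univ i))
    have h2 := h1.natFactorization_le_one p
    have h3 := hp.factorization_pos_of_dvd (by have := hb.1 i; omega) hi
    rw [show (b i).factorization p = 1 by omega, mul_one]
  · intro j _ hj
    rw [Nat.factorization_eq_zero_of_not_dvd (not_dvd_of_dvd_of_ne hb hp hj hi), mul_zero]
  · simp

/-- A prime divides at most one `b i`, and then has exponent `k + (i + 1)` with `0 < i + 1 < k`. The
residue mod `k` thus recovers `b`, and it is unaffected by a factor `a ^ k`; uniqueness and the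
exclusion of perfect powers both follow. -/
theorem dvd_iff_factorization_radicand_mod {k : ℕ} {b : Fin (k - 1) → ℕ} (hb : IsAdmissible b)
    {p : ℕ} (hp : p.Prime) (i : Fin (k - 1)) :
    p ∣ b i ↔ (radicand b).factorization p % k = (i : ℕ) + 1 := by
  have hmod : ∀ j : Fin (k - 1), p ∣ b j → (radicand b).factorization p % k = (j : ℕ) + 1 := by
    intro j hj
    have := j.2
    rw [factorization_radicand_of_dvd hb hp hj, Nat.add_mod_left, Nat.mod_eq_of_lt (by omega)]
  refine ⟨hmod i, fun h => ?_⟩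
  by_cases hex : ∃ j, p ∣ b j
  · obtain ⟨j, hj⟩ := hex
    have : j = i := Fin.ext (by have := hmod j hj; omega)
    exact this ▸ hj
  · push Not at hex
    rw [factorization_radicand hb, Finset.sum_eq_zero] at h
    · simp at h
    · intro j _
      rw [Nat.factorization_eq_zero_of_not_dvd (hex j), mul_zero]

theorem admissible_unique {k : ℕ} {b b' : Fin (k - 1) → ℕ} (hb : IsAdmissible b)
    (hb' : IsAdmissible b') {a c : ℕ} (ha : a ≠ 0) (hc : c ≠ 0)
    (h : a ^ k * radicand b = c ^ k * radicand b') : b = b' := by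
  funext i
  rw [Nat.Squarefree.ext_iff
    (hb.2.2.squarefree_of_dvd (Finset.dvd_prod_of_mem _ (Finset.mem_univ i)))
    (hb'.2.2.squarefree_of_dvd (Finset.dvd_prod_of_mem _ (Finset.mem_univ i)))]
  intro p hp
  rw [dvd_iff_factorization_radicand_mod hb hp, dvd_iff_factorization_radicand_mod hb' hp]
  have h1 := congrArg (fun n => n.factorization p % k) h
  simp only [Nat.factorization_mul (pow_ne_zero k ha) (radicand_pos hb).ne',
    Nat.factorization_mul (pow_ne_zero k hc) (radicand_pos hb').ne', Nat.factorization_pow,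
    Finsupp.add_apply, Finsupp.smul_apply, smul_eq_mul, Nat.mul_add_mod] at h1
  rw [h1]

theorem not_pow_of_admissible {k : ℕ} {b : Fin (k - 1) → ℕ} (hb : IsAdmissible b) {a c : ℕ}
    (ha : a ≠ 0) : a ^ k * radicand b ≠ c ^ k := by
  intro h
  obtain ⟨p, hp, hdvd⟩ := Nat.exists_prime_and_dvd (n := ∏ i, b i) (by have := hb.2.1; omega)
  obtain ⟨i, -, hi⟩ := (Prime.dvd_finsetProd_iff hp.prime _).1 hdvd
  have h1 := congrArg (fun n => n.factorization p % k) h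
  simp only [Nat.factorization_mul (pow_ne_zero k ha) (radicand_pos hb).ne',
    Nat.factorization_pow, (dvd_iff_factorization_radicand_mod hb hp i).1 hi,
    Finsupp.add_apply, Finsupp.smul_apply, smul_eq_mul, Nat.mul_add_mod, Nat.mul_mod_right] at h1
  omega

theorem mem_fullNonPowers_of_admissible {k : ℕ} {b : Fin (k - 1) → ℕ}
    (hb : IsAdmissible b) {a : ℕ} (ha : a ≠ 0) : a ^ k * radicand b ∈ fullNonPowers k := by
  refine ⟨⟨Nat.mul_pos (pow_pos (Nat.pos_of_ne_zero ha) k) (radicand_pos hb), ?_⟩, ?_⟩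
  · intro p hp hdvd
    rcases hp.dvd_mul.1 hdvd with h | h
    · exact (pow_dvd_pow_of_dvd (hp.dvd_of_dvd_pow h) k).mul_right _
    · obtain ⟨i, -, hi⟩ := (Prime.dvd_finsetProd_iff hp.prime _).1 h
      refine Dvd.dvd.mul_left ?_ _
      refine (pow_dvd_pow_of_dvd (hp.dvd_of_dvd_pow hi) k).trans ?_
      exact (pow_dvd_pow _ (by omega)).trans
        (Finset.dvd_prod_of_mem (fun i => b i ^ (k + ((i : ℕ) + 1))) (Finset.mem_univ i))
  · rintro ⟨c, hc⟩
    exact not_pow_of_admissible hb ha hc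

theorem exists_admissible_of_mem_fullNonPowers {k : ℕ} (hk : 2 ≤ k) {s : ℕ}
    (hs : s ∈ fullNonPowers k) :
    ∃ (a : ℕ) (b : Fin (k - 1) → ℕ), a ≠ 0 ∧ IsAdmissible b ∧ s = a ^ k * radicand b := by
  obtain ⟨⟨hs1, hfull⟩, hnp⟩ := hs
  have hs0 : s ≠ 0 := by omega
  let v : ℕ → ℕ := fun p => s.factorization p
  let b : Fin (k - 1) → ℕ := fun i => ∏ p ∈ s.primeFactors, if v p % k = (i : ℕ) + 1 then p else 1
  -- For residue `r ≠ 0` one block of `k` is left to the radicand, whose exponent is `k + r`. Since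
  -- `s` is `k`-full, `v p / k ≥ 1` and the subtraction does not truncate.
  let e : ℕ → ℕ := fun p => if v p % k = 0 then v p / k else v p / k - 1
  let a : ℕ := ∏ p ∈ s.primeFactors, p ^ e p
  have hprime : ∀ p ∈ s.primeFactors, p.Prime := fun p hp => Nat.prime_of_mem_primeFactors hp
  have hsum : ∀ (M : ℕ → ℕ) (r : ℕ), r < k →
      (∏ i : Fin (k - 1), if r = (i : ℕ) + 1 then M i else 1) =
        if r = 0 then 1 else M (r - 1) := by
    intro M r hr
    by_cases h0 : r = 0
    · subst h0; simp
    · rw [if_neg h0, Finset.prod_eq_single (⟨r - 1, by omega⟩ : Fin (k - 1))]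
      · rw [if_pos (by simp; omega)]
      · intro j _ hj
        rw [if_neg]
        intro h
        exact hj (Fin.ext (by simp; omega))
      · simp
  have hrad : radicand b = ∏ p ∈ s.primeFactors, if v p % k = 0 then 1 else p ^ (k + v p % k) := by
    simp only [radicand, b, ← Finset.prod_pow]
    rw [Finset.prod_comm]
    refine Finset.prod_congr rfl fun p hp => ?_
    have := hsum (fun i => p ^ (k + (i + 1))) (v p % k) (Nat.mod_lt _ (by omega))
    simp only [ite_pow, one_pow]
    rw [this]
    split_ifs with h0
    · rfl
    · congr 2; omega
  have hprod : ∏ i, b i = ∏ p ∈ s.primeFactors, if v p % k = 0 then 1 else p := by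
    simp only [b]
    rw [Finset.prod_comm]
    exact Finset.prod_congr rfl fun p hp => hsum (fun _ => p) (v p % k) (Nat.mod_lt _ (by omega))
  have heq : s = a ^ k * radicand b := by
    conv_lhs => rw [← Nat.prod_factorization_pow_eq_self hs0]
    rw [hrad, Finsupp.prod, Nat.support_factorization, ← Finset.prod_pow, ← Finset.prod_mul_distrib]
    refine Finset.prod_congr rfl fun p hp => ?_
    have hvk : k ≤ v p := ((hprime p hp).pow_dvd_iff_le_factorization hs0).1
      (hfull p (hprime p hp) (Nat.dvd_of_mem_primeFactors hp))
    have hdm := Nat.div_add_mod (v p) k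
    have hd1 : 1 ≤ v p / k := (Nat.one_le_div_iff (by omega)).2 hvk
    change p ^ v p = (p ^ e p) ^ k * _
    rw [← pow_mul]
    simp only [e]
    split_ifs with h0
    · rw [mul_one]
      congr 1
      rw [h0] at hdm
      rw [mul_comm]; omega
    · rw [← pow_add]
      congr 1
      obtain ⟨q, hq⟩ : ∃ q, v p / k = q + 1 := ⟨v p / k - 1, by omega⟩
      rw [hq] at hdm ⊢
      rw [Nat.add_sub_cancel]
      linarith [hdm, mul_add k q 1, mul_comm k q]
  have ha0 : a ≠ 0 := Finset.prod_ne_zero_iff.2 fun p hp => pow_ne_zero _ (hprime p hp).ne_zero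
  have hbpos : ∀ i, 1 ≤ b i := by
    intro i
    refine Nat.one_le_iff_ne_zero.2 (Finset.prod_ne_zero_iff.2 fun p hp => ?_)
    split_ifs
    · exact (hprime p hp).ne_zero
    · exact one_ne_zero
  refine ⟨a, b, ha0, ⟨hbpos, ?_, ?_⟩, heq⟩
  -- If all `b i` were `1`, then `s = a ^ k` would be a perfect power.
  · by_contra hlt
    have hpos : 0 < ∏ i, b i := Finset.prod_pos fun i _ => hbpos i
    have h1 : ∏ i, b i = 1 := by omega
    have h2 : ∀ i, b i = 1 := fun i => by
      simpa using (Finset.prod_eq_one_iff.1 h1) i (Finset.mem_univ i)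
    apply hnp
    refine ⟨a, ?_⟩
    rw [heq]
    simp [radicand, h2]
  · simp only [hprod, ← ite_not (v _ % k = 0)]
    rw [← Finset.prod_filter]
    refine (Finset.squarefree_prod_of_pairwise_isCoprime ?_ ?_)
    · intro p hp q hq hpq
      simp only [Finset.coe_filter, Set.mem_ofPred_eq] at hp hq
      exact Nat.coprime_iff_isRelPrime.1 ((Nat.coprime_primes (hprime p hp.1) (hprime q hq.1)).2 hpq)
    · intro p hp
      exact (hprime p (Finset.mem_filter.1 hp).1).prime.squarefree

/-! ### Size and rational independence of the elements of `Λ_k` -/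

theorem exists_admissible_of_mem_Lam {k : ℕ} (hk : 2 ≤ k) {x : ℝ} (hx : x ∈ Lam k) :
    ∃ b : Fin (k - 1) → ℕ, IsAdmissible b ∧ 0 < x ∧ x ^ k = radicand b := by
  obtain ⟨b, h1, h2, h3, rfl⟩ := hx
  have hcast : (∏ i : Fin (k - 1), (b i : ℝ) ^ (k + ((i : ℕ) + 1))) = (radicand b : ℝ) := by
    simp [radicand]
  have hb : IsAdmissible b := ⟨h1, h2, h3⟩
  refine ⟨b, hb, ?_, ?_⟩
  · rw [hcast]
    exact Real.rpow_pos_of_pos (by exact_mod_cast radicand_pos hb) _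
  · rw [hcast, one_div, Real.rpow_inv_natCast_pow (by positivity) (by omega)]

theorem exists_mem_Lam_of_admissible {k : ℕ} (hk : 2 ≤ k) {b : Fin (k - 1) → ℕ}
    (hb : IsAdmissible b) : ∃ x ∈ Lam k, 0 < x ∧ x ^ k = radicand b := by
  have hcast : (∏ i : Fin (k - 1), (b i : ℝ) ^ (k + ((i : ℕ) + 1))) = (radicand b : ℝ) := by
    simp [radicand]
  refine ⟨_, ⟨b, hb.1, hb.2.1, hb.2.2, rfl⟩, ?_, ?_⟩
  · rw [hcast]
    exact Real.rpow_pos_of_pos (by exact_mod_cast radicand_pos hb) _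
  · rw [hcast, one_div, Real.rpow_inv_natCast_pow (by positivity) (by omega)]

theorem Lam_pos {k : ℕ} (hk : 2 ≤ k) (x : Lam k) : (0 : ℝ) < x := by
  obtain ⟨b, -, h, -⟩ := exists_admissible_of_mem_Lam hk x.2
  exact h

/-- The radicand is at least `2 ^ (k + 1)`. The bound `2` is what separates consecutive multiples of
`λ` and keeps the two arcs of length `1/λ` disjoint. -/
theorem two_lt_Lam {k : ℕ} (hk : 2 ≤ k) (x : Lam k) : (2 : ℝ) < x := by
  obtain ⟨b, hb, h, hxb⟩ := exists_admissible_of_mem_Lam hk x.2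
  refine lt_of_pow_lt_pow_left₀ k h.le ?_
  rw [hxb]
  have h1 : (∏ i, b i) ^ (k + 1) ≤ radicand b := by
    rw [← Finset.prod_pow]
    refine Finset.prod_le_prod' fun i _ => Nat.pow_le_pow_right (hb.1 i) (by omega)
  have h2 : 2 ^ k < radicand b :=
    (Nat.pow_lt_pow_right one_lt_two (Nat.lt_succ_self k)).trans_le
      ((Nat.pow_le_pow_left hb.2.1 _).trans h1)
  exact_mod_cast h2

theorem Lam_eq_of_mul_eq_mul {k : ℕ} (hk : 2 ≤ k) (x y : Lam k) {a c : ℕ} (ha : a ≠ 0)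
    (hc : c ≠ 0) (h : (a : ℝ) * x = c * y) : x = y := by
  obtain ⟨b, hb, hx, hxb⟩ := exists_admissible_of_mem_Lam hk x.2
  obtain ⟨b', hb', hy, hyb⟩ := exists_admissible_of_mem_Lam hk y.2
  have h1 : ((a ^ k * radicand b : ℕ) : ℝ) = ((c ^ k * radicand b' : ℕ) : ℝ) := by
    push_cast
    rw [← hxb, ← hyb, ← mul_pow, ← mul_pow, h]
  have h2 := admissible_unique hb hb' ha hc (by exact_mod_cast h1)
  subst h2
  exact Subtype.ext ((pow_left_inj₀ hx.le hy.le (by omega)).1 (hxb.trans hyb.symm))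

theorem natCast_mul_Lam_ne {k : ℕ} (hk : 2 ≤ k) (x : Lam k) {a c : ℕ} (ha : a ≠ 0) :
    (a : ℝ) * x ≠ c := by
  intro h
  obtain ⟨b, hb, hx, hxb⟩ := exists_admissible_of_mem_Lam hk x.2
  refine not_pow_of_admissible (c := c) hb ha ?_
  have h1 : ((a ^ k * radicand b : ℕ) : ℝ) = ((c ^ k : ℕ) : ℝ) := by
    push_cast
    rw [← hxb, ← mul_pow, h]
  exact_mod_cast h1

theorem exists_natCast_mul_eq_of_pos {x y : ℝ} (hx : 0 < x) (hy : 0 < y)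
    (h : ¬ Irrational (x / y)) : ∃ a c : ℕ, a ≠ 0 ∧ c ≠ 0 ∧ (a : ℝ) * x = c * y := by
  rw [Irrational, not_not] at h
  obtain ⟨q, hq⟩ := h
  have hq0 : 0 < q := by
    have : (0 : ℝ) < q := hq ▸ div_pos hx hy
    exact_mod_cast this
  refine ⟨q.den, q.num.toNat, q.den_ne_zero, ?_, ?_⟩
  · have := Rat.num_pos.2 hq0
    omega
  · have h1 : ((q.num.toNat : ℕ) : ℝ) = (q.num : ℝ) := by
      have : ((q.num.toNat : ℕ) : ℤ) = q.num := Int.toNat_of_nonneg (Rat.num_pos.2 hq0).le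
      exact_mod_cast this
    have h2 : (q : ℝ) = q.num / q.den := by exact_mod_cast (Rat.num_div_den q).symm
    have h3 : (q.den : ℝ) ≠ 0 := by exact_mod_cast q.den_ne_zero
    rw [h1]
    rw [h2] at hq
    field_simp at hq
    linarith

theorem irrational_Lam_div {k : ℕ} (hk : 2 ≤ k) {x y : Lam k} (hxy : x ≠ y) :
    Irrational ((x : ℝ) / y) := by
  by_contra h
  obtain ⟨a, c, ha, hc, hac⟩ := exists_natCast_mul_eq_of_pos (Lam_pos hk x) (Lam_pos hk y) h
  exact hxy (Lam_eq_of_mul_eq_mul hk x y ha hc hac)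

theorem irrational_Lam {k : ℕ} (hk : 2 ≤ k) (x : Lam k) : Irrational (x : ℝ) := by
  by_contra h
  obtain ⟨a, c, ha, hc, hac⟩ := exists_natCast_mul_eq_of_pos (Lam_pos hk x) one_pos
    (by rwa [div_one])
  exact natCast_mul_Lam_ne hk x ha (by rw [hac, mul_one])

/-- An integer relation modulo `1` is a rational relation among the `1/λ` and `1`. All pairwise
ratios of these radicals are irrational, by uniqueness of the representation and because elements of
`S_k` are not perfect powers. -/
theorem isGeneric_Lam {k : ℕ} (hk : 2 ≤ k) (F : Finset (Lam k)) :
    UnitAddTorus.IsGeneric (fun x : F => (((1 / (x : Lam k) : ℝ)) : UnitAddCircle)) := by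
  intro h hh
  have h1 : ∃ z : ℤ, ∑ x : F, (h x : ℝ) * (1 / ((x : Lam k) : ℝ)) = z := by
    have h2 : ((∑ x : F, (h x : ℝ) * (1 / ((x : Lam k) : ℝ)) : ℝ) : UnitAddCircle) = ((0 : ℝ) : UnitAddCircle) := by
      rw [AddCircle.coe_zero, ← hh]
      have := map_sum (QuotientAddGroup.mk' (AddSubgroup.zmultiples (1 : ℝ)))
        (fun x : F => (h x : ℝ) * (1 / ((x : Lam k) : ℝ))) Finset.univ
      refine this.trans (Finset.sum_congr rfl fun x _ => ?_)
      rw [← zsmul_eq_mul]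
      rfl
    obtain ⟨z, hz⟩ := UnitAddCircle.coe_eq_coe_iff.1 h2
    exact ⟨z, by rw [hz, zero_add]⟩
  obtain ⟨z, hz⟩ := h1
  -- The index `none` carries the number `1`, which absorbs the integer `z`.
  let α : Option F → ℝ := fun o => o.elim 1 fun x => 1 / ((x : Lam k) : ℝ)
  have hrat : ∀ x : Lam k, ∃ q : ℚ, (1 / (x : ℝ)) ^ k = q := by
    intro x
    obtain ⟨b, -, -, hxb⟩ := exists_admissible_of_mem_Lam hk x.2
    exact ⟨1 / (radicand b : ℚ), by rw [div_pow, hxb]; push_cast; simp⟩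
  choose q hq using hrat
  have hlin : LinearIndependent ℚ α := by
    refine linearIndependent_of_pow_eq α ?_ (by omega : 0 < k)
      (fun o => o.elim 1 fun x => q x) ?_ ?_
    · rintro (_ | x)
      · exact one_pos
      · exact one_div_pos.2 (Lam_pos hk x)
    · rintro (_ | x)
      · simp [α]
      · exact hq x
    · rintro (_ | x) (_ | y) hxy
      · exact absurd rfl hxy
      · simpa [α] using irrational_Lam hk (y : Lam k)
      · simpa [α] using irrational_Lam hk (x : Lam k)
      · have hne : (y : Lam k) ≠ x := fun h => hxy (by rw [Subtype.ext h])
        have := irrational_Lam_div hk hne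
        simp only [α, Option.elim]
        rwa [div_div_div_eq, one_mul, mul_one]
  rw [Fintype.linearIndependent_iff] at hlin
  have := hlin (fun o => o.elim (-(z : ℚ)) fun x => (h x : ℚ)) ?_
  · funext x
    simpa using this (some x)
  · rw [Fintype.sum_option]
    simp only [α, Option.elim, Rat.smul_def]
    push_cast
    rw [hz]
    ring

/-! ### Convergence of `∑ 1/λ` -/

/-- Any finite set of tuples lies in a box, over which the sum factors. -/
theorem summable_pi_prod {ι : Type*} [Fintype ι] {f : ι → ℕ → ℝ} (h0 : ∀ i n, 0 ≤ f i n)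
    (hf : ∀ i, Summable (f i)) : Summable fun b : ι → ℕ => ∏ i, f i (b i) := by
  classical
  refine summable_of_sum_le (c := ∏ i, ∑' n, f i n)
    (fun b => Finset.prod_nonneg fun i _ => h0 i _) fun u => ?_
  calc ∑ b ∈ u, ∏ i, f i (b i)
      ≤ ∑ b ∈ Fintype.piFinset fun i => u.image fun b => b i, ∏ i, f i (b i) := by
        refine Finset.sum_le_sum_of_subset_of_nonneg ?_ fun b _ _ =>
          Finset.prod_nonneg fun i _ => h0 i _
        intro b hb
        exact Fintype.mem_piFinset.2 fun i => Finset.mem_image_of_mem (fun b => b i) hb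
    _ = ∏ i, ∑ n ∈ u.image fun b => b i, f i n := by rw [Finset.prod_univ_sum]
    _ ≤ ∏ i, ∑' n, f i n := Finset.prod_le_prod
        (fun i _ => Finset.sum_nonneg fun n _ => h0 i n)
        fun i _ => (hf i).sum_le_tsum _ fun n _ => h0 i n

/-- Forgetting squarefreeness embeds the series in a product of the series `∑ n ^ (-(k + i + 1) /
k)`, whose exponents exceed `1` in absolute value. -/
theorem summable_one_div_Lam {k : ℕ} (hk : 2 ≤ k) : Summable fun x : Lam k => 1 / (x : ℝ) := by
  have hk0 : (0 : ℝ) < k := by exact_mod_cast (by omega : 0 < k)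
  have hsum := summable_pi_prod (ι := Fin (k - 1))
    (f := fun i n => (n : ℝ) ^ (-(((k + ((i : ℕ) + 1) : ℕ) : ℝ) / k)))
    (fun i n => by positivity) (fun i => by
      rw [Real.summable_nat_rpow, neg_lt_neg_iff, one_lt_div hk0]
      exact_mod_cast (by omega : k < k + ((i : ℕ) + 1)))
  choose b hb using fun x : Lam k => x.2
  have hinj : Function.Injective b := by
    intro x y hxy
    apply Subtype.ext
    rw [(hb x).2.2.2, (hb y).2.2.2, hxy]
  refine (hsum.comp_injective hinj).congr fun x => ?_
  conv_rhs => rw [(hb x).2.2.2]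
  rw [← Real.finsetProd_rpow _ _ fun i _ => by positivity, one_div, ← Finset.prod_inv_distrib]
  refine Finset.prod_congr rfl fun i _ => ?_
  rw [← Real.rpow_natCast, ← Real.rpow_mul (by positivity), ← Real.rpow_neg (by positivity),
    mul_one_div]

/-! ### Counting elements of `S_k` by multiples of `λ` -/

/-- The set of those `x` in `Lam k` that have a multiple between `n` and `n + 1`. -/
def hits (k n : ℕ) : Set (Lam k) :=
  {x | ∃ a : ℕ, (n : ℝ) < a * x ∧ (a : ℝ) * x < n + 1}

theorem ncard_Ioo_inter_fullNonPowers {k : ℕ} (hk : 2 ≤ k) (n : ℕ) :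
    (Set.Ioo (n ^ k) ((n + 1) ^ k) ∩ fullNonPowers k).ncard = (hits k n).ncard := by
  have hk0 : k ≠ 0 := by omega
  have hex : ∀ s ∈ Set.Ioo (n ^ k) ((n + 1) ^ k) ∩ fullNonPowers k,
      ∃ (x : Lam k) (a : ℕ), a ≠ 0 ∧ (s : ℝ) = (a * x : ℝ) ^ k := by
    rintro s ⟨-, hs⟩
    obtain ⟨a, b, ha, hb, rfl⟩ := exists_admissible_of_mem_fullNonPowers hk hs
    obtain ⟨x, hx, hx0, hxb⟩ := exists_mem_Lam_of_admissible hk hb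
    exact ⟨⟨x, hx⟩, a, ha, by push_cast; rw [mul_pow, hxb]⟩
  have hlt : ∀ {m : ℕ} {y : ℝ}, 0 ≤ y → ((m : ℝ) < y ↔ ((m ^ k : ℕ) : ℝ) < y ^ k) := by
    intro m y hy
    push_cast
    rw [pow_lt_pow_iff_left₀ (by positivity) hy hk0]
  have hlt' : ∀ {m : ℕ} {y : ℝ}, 0 ≤ y → (y < (m : ℝ) ↔ y ^ k < ((m ^ k : ℕ) : ℝ)) := by
    intro m y hy
    push_cast
    rw [pow_lt_pow_iff_left₀ hy (by positivity) hk0]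
  choose f a ha hf using hex
  have hmem : ∀ s hs, (n : ℝ) < a s hs * f s hs ∧ (a s hs : ℝ) * f s hs < n + 1 := by
    intro s hs
    have h0 : (0 : ℝ) ≤ a s hs * f s hs := mul_nonneg (by positivity) (Lam_pos hk _).le
    constructor
    · rw [hlt h0, ← hf]
      exact_mod_cast hs.1.1
    · have : (a s hs : ℝ) * f s hs < (n + 1 : ℕ) := by
        rw [hlt' h0, ← hf]
        exact_mod_cast hs.1.2
      exact_mod_cast this
  refine Set.ncard_congr f (fun s hs => ⟨a s hs, hmem s hs⟩) ?_ ?_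
  · intro s t hs ht hst
    have h1 := hmem s hs
    have h2 := hmem t ht
    have hx := two_lt_Lam hk (f t ht)
    rw [hst] at h1
    -- Distinct multiples of `λ > 2` cannot lie in the same unit interval.
    have haa : a s hs = a t ht := by
      by_contra hne
      rcases Nat.lt_or_gt_of_ne hne with h | h
      · have : (a s hs : ℝ) + 1 ≤ a t ht := by exact_mod_cast h
        nlinarith
      · have : (a t ht : ℝ) + 1 ≤ a s hs := by exact_mod_cast h
        nlinarith
    have : (s : ℝ) = t := by rw [hf s hs, hf t ht, haa, hst]
    exact_mod_cast this
  · rintro x ⟨c, hc1, hc2⟩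
    obtain ⟨b, hb, hx, hxb⟩ := exists_admissible_of_mem_Lam hk x.2
    have hc0 : c ≠ 0 := by
      rintro rfl
      have : (0 : ℝ) ≤ n := by positivity
      simp at hc1
      linarith
    have h0 : (0 : ℝ) ≤ c * x := mul_nonneg (by positivity) hx.le
    have hs : ((c ^ k * radicand b : ℕ) : ℝ) = (c * x : ℝ) ^ k := by
      push_cast
      rw [mul_pow, hxb]
    have hsm : c ^ k * radicand b ∈ Set.Ioo (n ^ k) ((n + 1) ^ k) ∩ fullNonPowers k := by
      refine ⟨⟨?_, ?_⟩, mem_fullNonPowers_of_admissible hb hc0⟩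
      · rw [hlt h0, ← hs] at hc1
        exact_mod_cast hc1
      · have hc2' : (c : ℝ) * x < (n + 1 : ℕ) := by exact_mod_cast hc2
        rw [hlt' h0, ← hs] at hc2'
        exact_mod_cast hc2'
    refine ⟨_, hsm, ?_⟩
    refine Lam_eq_of_mul_eq_mul hk _ _ (ha _ hsm) hc0 ?_
    refine (pow_left_inj₀ (mul_nonneg (by positivity) (Lam_pos hk _).le) h0 hk0).1 ?_
    rw [← hf, hs]

/-! ### Expansion into elementary symmetric sums -/

theorem sum_powerset_powerset_sdiff {ι M : Type*} [DecidableEq ι] [AddCommMonoid M] (F : Finset ι)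
    (f : Finset ι → Finset ι → M) :
    ∑ L ∈ F.powerset, ∑ V ∈ (F \ L).powerset, f L V =
      ∑ U ∈ F.powerset, ∑ L ∈ U.powerset, f L (U \ L) := by
  rw [Finset.sum_sigma', Finset.sum_sigma']
  refine Finset.sum_bij' (fun p _ => ⟨p.1 ∪ p.2, p.1⟩) (fun p _ => ⟨p.2, p.1 \ p.2⟩) ?_ ?_ ?_ ?_ ?_
  · rintro ⟨L, V⟩ h
    simp only [Finset.mem_sigma, Finset.mem_powerset] at h ⊢
    exact ⟨Finset.union_subset h.1 (h.2.trans Finset.sdiff_subset), Finset.subset_union_left⟩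
  · rintro ⟨U, L⟩ h
    simp only [Finset.mem_sigma, Finset.mem_powerset] at h ⊢
    exact ⟨h.2.trans h.1, Finset.sdiff_subset_sdiff h.1 subset_rfl⟩
  · rintro ⟨L, V⟩ h
    simp only [Finset.mem_sigma, Finset.mem_powerset] at h ⊢
    have hd : Disjoint V L := Finset.disjoint_of_subset_left h.2 Finset.sdiff_disjoint
    rw [Finset.union_sdiff_cancel_left hd.symm]
  · rintro ⟨U, L⟩ h
    simp only [Finset.mem_sigma, Finset.mem_powerset] at h ⊢
    rw [Finset.union_sdiff_of_subset h.2]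
  · rintro ⟨L, V⟩ h
    simp only [Finset.mem_sigma, Finset.mem_powerset] at h ⊢
    have hd : Disjoint V L := Finset.disjoint_of_subset_left h.2 Finset.sdiff_disjoint
    rw [Finset.union_sdiff_cancel_left hd.symm]

/-- The coefficient of the elementary symmetric sum of degree `r` in the density. -/
def densityCoeff (l m r : ℕ) : ℝ :=
  (r.choose l : ℝ) * ((r - l).choose m : ℝ) * (-2) ^ (r - l - m)

/-- Expanding `∏ (1 - 2w)` over subsets `N` and collecting by `U = L ∪ M ∪ N` leaves `∏_U w`, with
weight `(-2) ^ |N|` times the number of ways to choose `L` and then `M` inside `U`. -/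
theorem sum_powersetCard_prod_eq {ι : Type*} [DecidableEq ι] (w : ι → ℝ) (l m : ℕ) (F : Finset ι) :
    ∑ L ∈ F.powersetCard l, ∑ M ∈ (F \ L).powersetCard m,
      (∏ x ∈ L, w x) * ((∏ x ∈ M, w x) * ∏ x ∈ (F \ L) \ M, (1 - 2 * w x)) =
    ∑ U ∈ F.powerset, densityCoeff l m U.card * ∏ x ∈ U, w x := by
  have h1 : ∀ G : Finset ι, ∏ x ∈ G, (1 - 2 * w x) =
      ∑ N ∈ G.powerset, (-2) ^ N.card * ∏ x ∈ N, w x := by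
    intro G
    simp_rw [sub_eq_add_neg, Finset.prod_one_add]
    refine Finset.sum_congr rfl fun N _ => ?_
    rw [← Finset.prod_const, ← Finset.prod_mul_distrib]
    exact Finset.prod_congr rfl fun x _ => by ring
  have h2 : ∀ L : Finset ι, ∑ M ∈ (F \ L).powersetCard m,
      (∏ x ∈ L, w x) * ((∏ x ∈ M, w x) * ∏ x ∈ (F \ L) \ M, (1 - 2 * w x)) =
      ∑ V ∈ (F \ L).powerset, ∑ M ∈ V.powersetCard m,
        (∏ x ∈ L, w x) * ((∏ x ∈ M, w x) * ((-2) ^ (V \ M).card * ∏ x ∈ V \ M, w x)) := by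
    intro L
    simp_rw [Finset.powersetCard_eq_filter, Finset.sum_filter]
    rw [← sum_powerset_powerset_sdiff (F \ L) (fun M N => if M.card = m then
      (∏ x ∈ L, w x) * ((∏ x ∈ M, w x) * ((-2) ^ N.card * ∏ x ∈ N, w x)) else 0)]
    refine Finset.sum_congr rfl fun M _ => ?_
    split_ifs
    · rw [h1, Finset.mul_sum, Finset.mul_sum]
    · simp
  simp_rw [h2, Finset.powersetCard_eq_filter (s := F), Finset.sum_filter]
  have h3 := sum_powerset_powerset_sdiff F (fun L V => if L.card = l then
    ∑ M ∈ V.powersetCard m,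
        (∏ x ∈ L, w x) * ((∏ x ∈ M, w x) * ((-2) ^ (V \ M).card * ∏ x ∈ V \ M, w x)) else 0)
  have h4 : ∀ L ∈ F.powerset, (if L.card = l then ∑ V ∈ (F \ L).powerset, ∑ M ∈ V.powersetCard m,
        (∏ x ∈ L, w x) * ((∏ x ∈ M, w x) * ((-2) ^ (V \ M).card * ∏ x ∈ V \ M, w x)) else 0) =
      ∑ V ∈ (F \ L).powerset, if L.card = l then ∑ M ∈ V.powersetCard m,
        (∏ x ∈ L, w x) * ((∏ x ∈ M, w x) * ((-2) ^ (V \ M).card * ∏ x ∈ V \ M, w x)) else 0 := by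
    intro L _
    split_ifs <;> simp
  rw [Finset.sum_congr rfl h4, h3]
  refine Finset.sum_congr rfl fun U _ => ?_
  rw [← Finset.sum_filter, ← Finset.powersetCard_eq_filter]
  have h5 : ∀ L ∈ U.powersetCard l, ∑ M ∈ (U \ L).powersetCard m,
      (∏ x ∈ L, w x) * ((∏ x ∈ M, w x) * ((-2) ^ ((U \ L) \ M).card * ∏ x ∈ (U \ L) \ M, w x)) =
      ((U.card - l).choose m : ℝ) * ((-2) ^ (U.card - l - m) * ∏ x ∈ U, w x) := by
    intro L hL
    rw [Finset.mem_powersetCard] at hL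
    have h6 : ∀ M ∈ (U \ L).powersetCard m,
        (∏ x ∈ L, w x) * ((∏ x ∈ M, w x) * ((-2) ^ ((U \ L) \ M).card * ∏ x ∈ (U \ L) \ M, w x)) =
        (-2) ^ (U.card - l - m) * ∏ x ∈ U, w x := by
      intro M hM
      rw [Finset.mem_powersetCard] at hM
      rw [← Finset.prod_sdiff hL.1, ← Finset.prod_sdiff hM.1, Finset.card_sdiff_of_subset hM.1,
        Finset.card_sdiff_of_subset hL.1, hL.2, hM.2]
      ring
    rw [Finset.sum_congr rfl h6, Finset.sum_const, Finset.card_powersetCard,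
      Finset.card_sdiff_of_subset hL.1, hL.2, nsmul_eq_mul]
  rw [Finset.sum_congr rfl h5, Finset.sum_const, Finset.card_powersetCard, nsmul_eq_mul,
    densityCoeff]
  ring

theorem abs_densityCoeff_le (l m r : ℕ) : |densityCoeff l m r| ≤ 8 ^ r := by
  rw [densityCoeff, abs_mul, abs_mul, abs_pow, abs_neg, Nat.abs_cast, Nat.abs_cast,
    show (8 : ℝ) ^ r = 2 ^ r * 2 ^ r * |2| ^ r by rw [← mul_pow, ← mul_pow]; norm_num]
  have h1 : (r.choose l : ℝ) ≤ 2 ^ r := by exact_mod_cast Nat.choose_le_two_pow r l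
  have h2 : ((r - l).choose m : ℝ) ≤ 2 ^ r := by
    exact_mod_cast (Nat.choose_le_two_pow _ m).trans (Nat.pow_le_pow_right (by norm_num) (by omega))
  have h3 : |(2 : ℝ)| ^ (r - l - m) ≤ |(2 : ℝ)| ^ r :=
    pow_le_pow_right₀ (by norm_num) (by omega)
  gcongr

theorem densityCoeff_eq_zero {l m r : ℕ} (h : r < l + m) : densityCoeff l m r = 0 := by
  rw [densityCoeff]
  by_cases hl : r < l
  · simp [Nat.choose_eq_zero_of_lt hl]
  · simp [Nat.choose_eq_zero_of_lt (show r - l < m by omega)]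

theorem densityCoeff_add (l m n : ℕ) : densityCoeff l m (l + m + n) =
    (-2 : ℝ) ^ n * (Nat.multinomial Finset.univ ![l, m, n] : ℝ) := by
  have h1 : Nat.multinomial Finset.univ ![l, m, n] = (l + m + n).choose l * (m + n).choose m := by
    have h2 := Nat.multinomial_spec (Finset.univ : Finset (Fin 3)) ![l, m, n]
    simp [Fin.prod_univ_three, Fin.sum_univ_three] at h2
    have h3 := Nat.add_choose_mul_factorial_mul_factorial l (m + n)
    have h4 := Nat.add_choose_mul_factorial_mul_factorial m n
    rw [← Nat.choose_symm_add] at h3 h4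
    rw [← add_assoc] at h3
    have hpos : 0 < l.factorial * m.factorial * n.factorial := by positivity
    apply Nat.eq_of_mul_eq_mul_left hpos
    rw [h2, ← h3, ← h4]
    ring
  rw [densityCoeff, h1, show l + m + n - l = m + n by omega, Nat.add_sub_cancel_left]
  push_cast
  ring

/-- The bound `8 ^ |U|` on the coefficient is absorbed into the product as `∏ 8 w`, which is
summable over finite sets because `∑ 8 w` converges. -/
theorem summable_densityCoeff_mul_prod {ι : Type*} {w : ι → ℝ} (hw : Summable w)
    (hw0 : ∀ i, 0 ≤ w i) (l m : ℕ) :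
    Summable fun U : Finset ι => densityCoeff l m U.card * ∏ x ∈ U, w x := by
  have h1 : Summable fun U : Finset ι => ∏ x ∈ U, 8 * w x :=
    summable_finsetProd_of_summable_norm (by
      simpa [abs_of_nonneg (hw0 _)] using hw.mul_left 8)
  refine h1.of_norm_bounded fun U => ?_
  rw [Finset.prod_mul_distrib, Finset.prod_const, Real.norm_eq_abs, abs_mul,
    abs_of_nonneg (Finset.prod_nonneg fun x _ => hw0 x)]
  exact mul_le_mul_of_nonneg_right (abs_densityCoeff_le l m _)
    (Finset.prod_nonneg fun x _ => hw0 x)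

/-! ### Joint densities for finitely many `λ` -/

section

open MeasureTheory

theorem tendsto_sum_succ_div {f : ℕ → ℝ} {d : ℝ}
    (h : Tendsto (fun N : ℕ => (∑ n ∈ Finset.range N, f n) / N) atTop (𝓝 d)) :
    Tendsto (fun N : ℕ => (∑ n ∈ Finset.range N, f (n + 1)) / N) atTop (𝓝 d) := by
  have h1 := (tendsto_add_atTop_iff_nat 1).2 h
  have h2 : Tendsto (fun N : ℕ => ((N + 1 : ℕ) : ℝ) / N) atTop (𝓝 1) := by
    have : Tendsto (fun N : ℕ => 1 + 1 / (N : ℝ)) atTop (𝓝 (1 + 0)) :=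
      tendsto_const_nhds.add tendsto_one_div_atTop_nhds_zero_nat
    rw [add_zero] at this
    refine this.congr' ?_
    filter_upwards [eventually_ge_atTop 1] with N hN
    have hN0 : (N : ℝ) ≠ 0 := by exact_mod_cast (by omega : N ≠ 0)
    field_simp
    push_cast
    ring
  have h3 : Tendsto (fun N : ℕ => f 0 / (N : ℝ)) atTop (𝓝 0) :=
    tendsto_const_nhds.div_atTop tendsto_natCast_atTop_atTop
  have h4 := (h1.mul h2).sub h3
  rw [mul_one, sub_zero] at h4
  refine h4.congr fun N => ?_
  have hN1 : ((N + 1 : ℕ) : ℝ) ≠ 0 := by exact_mod_cast N.succ_ne_zero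
  rw [div_mul_div_cancel₀ hN1, Finset.sum_range_succ', ← sub_div, add_sub_cancel_right]

/-- Division of `n < a λ < n + 1` by `λ` gives `0 < (n+1)/λ - a < 1/λ`. Basing the orbit at `n + 1`
lets both neighbouring intervals be read off the same point, on either side of `0`. -/
theorem mem_hits_iff {k : ℕ} (hk : 2 ≤ k) (n : ℕ) (x : Lam k) :
    x ∈ hits k n ↔ (n + 1) • ((1 / (x : ℝ) : ℝ) : UnitAddCircle) ∈ openArc 0 (1 / (x : ℝ)) := by
  have hx := Lam_pos hk x
  rw [← AddCircle.coe_nsmul, coe_mem_openArc_iff]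
  have key : ∀ z : ℝ, (0 < (n + 1) • (1 / (x : ℝ)) - z ∧
      (n + 1) • (1 / (x : ℝ)) - z < 1 / (x : ℝ)) ↔ ((n : ℝ) < z * x ∧ z * x < n + 1) := by
    intro z
    rw [nsmul_eq_mul, mul_one_div, sub_pos, lt_div_iff₀ hx, sub_lt_iff_lt_add, ← sub_lt_iff_lt_add',
      ← sub_div, div_lt_iff₀ hx]
    push_cast
    rw [add_sub_cancel_right, and_comm]
  simp_rw [key]
  constructor
  · rintro ⟨a, h⟩
    exact ⟨a, by exact_mod_cast h⟩
  · rintro ⟨z, h⟩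
    have hz : (0 : ℝ) < z := by
      have : 0 < (z : ℝ) * x := lt_of_le_of_lt (by positivity) h.1
      exact pos_of_mul_pos_left this hx.le
    lift z to ℕ using (by exact_mod_cast hz.le)
    exact ⟨z, by exact_mod_cast h⟩

theorem mem_hits_succ_iff {k : ℕ} (hk : 2 ≤ k) (n : ℕ) (x : Lam k) :
    x ∈ hits k (n + 1) ↔
      (n + 1) • ((1 / (x : ℝ) : ℝ) : UnitAddCircle) ∈ openArc (-(1 / (x : ℝ))) 0 := by
  have hx := Lam_pos hk x
  rw [← AddCircle.coe_nsmul, coe_mem_openArc_iff]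
  have key : ∀ z : ℝ, (-(1 / (x : ℝ)) < (n + 1) • (1 / (x : ℝ)) - z ∧
      (n + 1) • (1 / (x : ℝ)) - z < 0) ↔ ((n + 1 : ℝ) < z * x ∧ z * x < n + 1 + 1) := by
    intro z
    rw [nsmul_eq_mul, mul_one_div, sub_neg, div_lt_iff₀ hx, neg_lt_sub_iff_lt_add, ← add_div,
      lt_div_iff₀ hx, and_comm]
    push_cast
    rw [add_comm (1 : ℝ)]
  simp_rw [key]
  constructor
  · rintro ⟨a, h⟩
    exact ⟨a, by exact_mod_cast h⟩
  · rintro ⟨z, h⟩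
    have hz : (0 : ℝ) < z := by
      have : 0 < (z : ℝ) * x := lt_of_le_of_lt (by positivity) h.1
      exact pos_of_mul_pos_left this hx.le
    lift z to ℕ using (by exact_mod_cast hz.le)
    exact ⟨z, by exact_mod_cast h⟩

-- Prescribing both hit sets exactly restricts each coordinate of the orbit separately, to an arc or
-- to the complement of both arcs, so Weyl's theorem for product sets applies.
open scoped Classical in
theorem tendsto_count_hits_eq {k : ℕ} (hk : 2 ≤ k) (F L M : Finset (Lam k)) (hL : L ⊆ F)
    (hM : M ⊆ F \ L) :
    Tendsto (fun N : ℕ => (((Finset.range N).filter fun n =>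
        F.filter (· ∈ hits k n) = L ∧ F.filter (· ∈ hits k (n + 1)) = M).card : ℝ) / N) atTop
      (𝓝 ((∏ x ∈ L, 1 / (x : ℝ)) * ((∏ x ∈ M, 1 / (x : ℝ)) *
        ∏ x ∈ (F \ L) \ M, (1 - 2 * (1 / (x : ℝ)))))) := by
  let I : Lam k → Set UnitAddCircle := fun x => openArc 0 (1 / (x : ℝ))
  let J : Lam k → Set UnitAddCircle := fun x => openArc (-(1 / (x : ℝ))) 0
  let B : Lam k → Set UnitAddCircle := fun x =>
    if x ∈ L then I x else if x ∈ M then J x else (I x ∪ J x)ᶜ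
  have hw0 : ∀ x : Lam k, 0 ≤ 1 / (x : ℝ) := fun x => one_div_nonneg.2 (Lam_pos hk x).le
  have hw : ∀ x : Lam k, 2 * (1 / (x : ℝ)) ≤ 1 := fun x => by
    rw [mul_one_div, div_le_one (Lam_pos hk x)]
    exact (two_lt_Lam hk x).le
  have hIm : ∀ x, MeasurableSet (I x) := fun x => (isOpen_openArc _ _).measurableSet
  have hJm : ∀ x, MeasurableSet (J x) := fun x => (isOpen_openArc _ _).measurableSet
  have hBm : ∀ x, MeasurableSet (B x) := by
    intro x
    simp only [B]
    split_ifs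
    exacts [hIm x, hJm x, ((hIm x).union (hJm x)).compl]
  have hBf : ∀ x, volume (frontier (B x)) = 0 := by
    intro x
    simp only [B]
    split_ifs
    exacts [volume_frontier_openArc _ _, volume_frontier_openArc _ _,
      volume_frontier_compl_openArc_union _]
  have hvol : ∀ x, (volume (B x)).toReal =
      if x ∈ L then 1 / (x : ℝ) else if x ∈ M then 1 / (x : ℝ) else 1 - 2 * (1 / (x : ℝ)) := by
    intro x
    have := hw x
    have := hw0 x
    simp only [B]
    split_ifs
    · rw [volume_openArc 0 le_rfl (by linarith), ENNReal.toReal_ofReal (by linarith), sub_zero]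
    · rw [volume_openArc (-1) (by linarith) (by linarith), ENNReal.toReal_ofReal (by linarith),
        sub_neg_eq_add, zero_add]
    · exact volume_compl_openArc_union (hw0 x) (hw x)
  have h := UnitAddTorus.tendsto_count_pi (isGeneric_Lam hk F) (B := fun x : F => B x)
    (fun x => hBf x) (fun x => hBm x)
  have hprod : ∏ x : F, (volume (B x)).toReal = (∏ x ∈ L, 1 / (x : ℝ)) * ((∏ x ∈ M, 1 / (x : ℝ)) *
        ∏ x ∈ (F \ L) \ M, (1 - 2 * (1 / (x : ℝ)))) := by
    rw [Finset.prod_coe_sort F (fun x => (volume (B x)).toReal), ← Finset.prod_sdiff hL,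
      ← Finset.prod_sdiff hM]
    have e1 : ∏ x ∈ L, (volume (B x)).toReal = ∏ x ∈ L, 1 / (x : ℝ) :=
      Finset.prod_congr rfl fun x hx => by rw [hvol, if_pos hx]
    have e2 : ∏ x ∈ M, (volume (B x)).toReal = ∏ x ∈ M, 1 / (x : ℝ) :=
      Finset.prod_congr rfl fun x hx => by
        rw [hvol, if_neg (Finset.mem_sdiff.1 (hM hx)).2, if_pos hx]
    have e3 : ∏ x ∈ (F \ L) \ M, (volume (B x)).toReal =
        ∏ x ∈ (F \ L) \ M, (1 - 2 * (1 / (x : ℝ))) :=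
      Finset.prod_congr rfl fun x hx => by
        simp only [Finset.mem_sdiff] at hx
        rw [hvol, if_neg hx.1.2, if_neg hx.2]
    rw [e1, e2, e3]
    ring
  rw [hprod] at h
  simp_rw [← Finset.sum_boole] at h ⊢
  -- Weyl's theorem averages over `n • θ`, whereas the hits at `n` concern `(n + 1) • θ`.
  refine (tendsto_sum_succ_div h).congr fun N => ?_
  congr 1
  refine Finset.sum_congr rfl fun n _ => ?_
  congr 1
  rw [eq_iff_iff, Finset.ext_iff, Finset.ext_iff, ← forall_and, Subtype.forall]
  refine forall_congr' fun x => ?_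
  by_cases hxF : x ∈ F
  · have hd := Set.disjoint_left.1 (disjoint_openArc (hw x))
    specialize @hd ((n + 1) • ((1 / (x : ℝ) : ℝ) : UnitAddCircle))
    have hLM : x ∈ M → x ∉ L := fun h => (Finset.mem_sdiff.1 (hM h)).2
    simp only [hxF, forall_const, Finset.mem_filter, true_and]
    rw [mem_hits_iff hk n, mem_hits_succ_iff hk n]
    change (_ ∈ B x) ↔ ((_ ∈ I x) ↔ _) ∧ ((_ ∈ J x) ↔ _)
    by_cases hxL : x ∈ L
    · have hxM : x ∉ M := fun h => hLM h hxL
      simp only [B, hxL, hxM, if_true]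
      tauto
    · by_cases hxM : x ∈ M
      · simp only [B, hxL, hxM, if_true, if_false]
        tauto
      · simp only [B, hxL, hxM, if_false, Set.mem_compl_iff, Set.mem_union]
        tauto
  · have hxL : x ∉ L := fun h => hxF (hL h)
    have hxM : x ∉ M := fun h => hxF (Finset.mem_sdiff.1 (hM h)).1
    simp [hxF, hxL, hxM]

open scoped Classical in
theorem tendsto_count_hits_card {k : ℕ} (hk : 2 ≤ k) (l m : ℕ) (F : Finset (Lam k)) :
    Tendsto (fun N : ℕ => (((Finset.range N).filter fun n =>
        (F.filter (· ∈ hits k n)).card = l ∧ (F.filter (· ∈ hits k (n + 1))).card = m).card : ℝ) / N)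
      atTop (𝓝 (∑ U ∈ F.powerset, densityCoeff l m U.card * ∏ x ∈ U, 1 / (x : ℝ))) := by
  rw [← sum_powersetCard_prod_eq (fun x : Lam k => 1 / (x : ℝ))]
  have h := tendsto_finsetSum (F.powersetCard l) fun L hL =>
    tendsto_finsetSum ((F \ L).powersetCard m) fun M hM =>
      tendsto_count_hits_eq hk F L M (Finset.mem_powersetCard.1 hL).1
        (Finset.mem_powersetCard.1 hM).1
  refine h.congr fun N => ?_
  simp_rw [← Finset.sum_div]
  congr 1
  simp_rw [← Finset.sum_boole]
  rw [Finset.sum_congr rfl fun L _ => Finset.sum_comm, Finset.sum_comm]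
  refine Finset.sum_congr rfl fun n _ => ?_
  -- No `λ` hits two consecutive intervals, so summing over `M ⊆ F \ L` misses no case.
  have hdisj : F.filter (· ∈ hits k (n + 1)) ⊆ F \ F.filter (· ∈ hits k n) := by
    intro x hx
    simp only [Finset.mem_filter, Finset.mem_sdiff] at hx ⊢
    refine ⟨hx.1, fun h => ?_⟩
    have hw : 2 * (1 / (x : ℝ)) ≤ 1 := by
      rw [mul_one_div, div_le_one (Lam_pos hk x)]
      exact (two_lt_Lam hk x).le
    exact Set.disjoint_left.1 (disjoint_openArc hw) ((mem_hits_iff hk n x).1 h.2)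
      ((mem_hits_succ_iff hk n x).1 hx.2)
  by_cases h1 : (F.filter (· ∈ hits k n)).card = l
  · rw [Finset.sum_eq_single (F.filter (· ∈ hits k n))]
    · by_cases h2 : (F.filter (· ∈ hits k (n + 1))).card = m
      · rw [Finset.sum_eq_single (F.filter (· ∈ hits k (n + 1)))]
        · simp [h1, h2]
        · intro M _ hM
          rw [if_neg fun h => hM h.2.symm]
        · intro h
          exact absurd (Finset.mem_powersetCard.2 ⟨hdisj, h2⟩) h
      · rw [if_neg fun h => h2 h.2]
        refine Finset.sum_eq_zero fun M hM => if_neg fun h => h2 ?_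
        rw [h.2]
        exact (Finset.mem_powersetCard.1 hM).2
    · intro L _ hL
      exact Finset.sum_eq_zero fun M _ => if_neg fun h => hL h.1.symm
    · intro h
      exact absurd (Finset.mem_powersetCard.2 ⟨Finset.filter_subset _ _, h1⟩) h
  · rw [if_neg fun h => h1 h.1]
    refine Finset.sum_eq_zero fun L hL => Finset.sum_eq_zero fun M _ => if_neg fun h => h1 ?_
    rw [h.1]
    exact (Finset.mem_powersetCard.1 hL).2

end

/-! ### Truncation error and passage to all of `Λ_k` -/

-- Different `n` use different multipliers `a ≥ 1` with `a λ < N`, and there are at most `N/λ` of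
-- these. Having no error term, the bound can be summed over infinitely many `λ`.
open scoped Classical in
theorem card_filter_mem_hits_le {k : ℕ} (hk : 2 ≤ k) (x : Lam k) (N : ℕ) :
    (((Finset.range N).filter fun n => x ∈ hits k n).card : ℝ) ≤ N * (1 / (x : ℝ)) := by
  have hx := Lam_pos hk x
  let g : ℕ → ℕ := fun n => if h : x ∈ hits k n then h.choose else 0
  have hg : ∀ n, x ∈ hits k n → (n : ℝ) < g n * x ∧ (g n : ℝ) * x < n + 1 := by
    intro n h
    simp only [g, h, dif_pos]
    exact Exists.choose_spec h
  have hcard : ((Finset.range N).filter fun n => x ∈ hits k n).card ≤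
      (Finset.Icc 1 ⌊N * (1 / (x : ℝ))⌋₊).card := by
    refine Finset.card_le_card_of_injOn g ?_ ?_
    · intro n hn
      simp only [Finset.coe_filter, Finset.mem_range, Set.mem_ofPred_eq] at hn
      obtain ⟨h1, h2⟩ := hg n hn.2
      simp only [Finset.coe_Icc, Set.mem_Icc]
      constructor
      · by_contra h0
        have : g n = 0 := by omega
        rw [this] at h1
        simp only [Nat.cast_zero, zero_mul] at h1
        have : (0 : ℝ) ≤ n := by positivity
        linarith
      · refine Nat.le_floor ?_
        rw [mul_one_div, le_div_iff₀ hx]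
        have : (n : ℝ) + 1 ≤ N := by exact_mod_cast hn.1
        linarith
    · intro n hn n' hn' heq
      simp only [Finset.coe_filter, Finset.mem_range, Set.mem_ofPred_eq] at hn hn'
      obtain ⟨h1, h2⟩ := hg n hn.2
      obtain ⟨h3, h4⟩ := hg n' hn'.2
      rw [heq] at h1 h2
      have h5 : (n : ℝ) < n' + 1 := by linarith
      have h6 : (n' : ℝ) < n + 1 := by linarith
      have h7 : n < n' + 1 := by exact_mod_cast h5
      have h8 : n' < n + 1 := by exact_mod_cast h6
      omega
  rw [Nat.card_Icc, Nat.add_sub_cancel] at hcard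
  exact (Nat.cast_le.2 hcard).trans
    (Nat.floor_le (mul_nonneg (by positivity) (one_div_nonneg.2 hx.le)))

open scoped Classical in
theorem card_filter_exists_hits_le {k : ℕ} (hk : 2 ≤ k) (F : Finset (Lam k)) (N : ℕ) :
    (((Finset.range N).filter fun n => ∃ x ∉ F, x ∈ hits k n).card : ℝ) ≤
      N * ∑' x : {x : Lam k // x ∉ F}, 1 / ((x : Lam k) : ℝ) := by
  -- One witness per `n` suffices, so the union bound runs over a finite set.
  let g : ℕ → Finset {x : Lam k // x ∉ F} := fun n =>
    if h : ∃ x ∉ F, x ∈ hits k n then {⟨h.choose, h.choose_spec.1⟩} else ∅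
  let G : Finset {x : Lam k // x ∉ F} := (Finset.range N).biUnion g
  have hsub : ((Finset.range N).filter fun n => ∃ x ∉ F, x ∈ hits k n) ⊆
      G.biUnion fun x => (Finset.range N).filter fun n => (x : Lam k) ∈ hits k n := by
    intro n hn
    rw [Finset.mem_filter] at hn
    obtain ⟨hnN, h⟩ := hn
    simp only [Finset.mem_biUnion, Finset.mem_filter, G]
    refine ⟨⟨h.choose, h.choose_spec.1⟩, ⟨n, hnN, ?_⟩, hnN, h.choose_spec.2⟩
    simp only [g, h, dif_pos, Finset.mem_singleton]
  have hsum : Summable fun x : {x : Lam k // x ∉ F} => 1 / ((x : Lam k) : ℝ) :=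
    (summable_one_div_Lam hk).subtype _
  calc (((Finset.range N).filter fun n => ∃ x ∉ F, x ∈ hits k n).card : ℝ)
      ≤ ((∑ x ∈ G, ((Finset.range N).filter fun n => (x : Lam k) ∈ hits k n).card : ℕ) : ℝ) := by
        exact_mod_cast (Finset.card_le_card hsub).trans Finset.card_biUnion_le
    _ ≤ ∑ x ∈ G, N * (1 / ((x : Lam k) : ℝ)) := by
        push_cast
        exact Finset.sum_le_sum fun x _ => card_filter_mem_hits_le hk x N
    _ = N * ∑ x ∈ G, 1 / ((x : Lam k) : ℝ) := by rw [Finset.mul_sum]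
    _ ≤ _ := by
        gcongr
        exact hsum.sum_le_tsum _ fun x _ => one_div_nonneg.2 (Lam_pos hk x).le

theorem abs_card_sub_card_le {α : Type*} [DecidableEq α] {A B C : Finset α}
    (h : ∀ n, n ∉ C → (n ∈ A ↔ n ∈ B)) : |(A.card : ℝ) - B.card| ≤ C.card := by
  have h1 : A.card ≤ B.card + C.card := by
    refine (Finset.card_le_card (t := B ∪ C) fun n hn => ?_).trans (Finset.card_union_le _ _)
    by_cases hC : n ∈ C
    · exact Finset.mem_union_right _ hC
    · exact Finset.mem_union_left _ ((h n hC).1 hn)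
  have h2 : B.card ≤ A.card + C.card := by
    refine (Finset.card_le_card (t := A ∪ C) fun n hn => ?_).trans (Finset.card_union_le _ _)
    by_cases hC : n ∈ C
    · exact Finset.mem_union_right _ hC
    · exact Finset.mem_union_left _ ((h n hC).2 hn)
  have h1' : (A.card : ℝ) ≤ B.card + C.card := by exact_mod_cast h1
  have h2' : (B.card : ℝ) ≤ A.card + C.card := by exact_mod_cast h2
  rw [abs_le]
  constructor <;> linarith

theorem mem_intervalSet_iff {k : ℕ} (hk : 2 ≤ k) (l m n : ℕ) :
    n ∈ intervalSet k l m ↔ 1 ≤ n ∧ (hits k n).ncard = l ∧ (hits k (n + 1)).ncard = m := by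
  rw [← ncard_Ioo_inter_fullNonPowers hk n, ← ncard_Ioo_inter_fullNonPowers hk (n + 1)]
  rfl

open scoped Classical in
theorem abs_count_sub_count_le {k : ℕ} (hk : 2 ≤ k) (l m : ℕ) (F : Finset (Lam k)) (N : ℕ) :
    |(((Finset.range N).filter fun n => n ∈ intervalSet k l m).card : ℝ) -
      (((Finset.range N).filter fun n => (F.filter (· ∈ hits k n)).card = l ∧
        (F.filter (· ∈ hits k (n + 1))).card = m).card : ℝ)| ≤
      1 + 2 * (N + 1) * ∑' x : {x : Lam k // x ∉ F}, 1 / ((x : Lam k) : ℝ) := by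
  have hcard : ∀ n, (¬ ∃ x ∉ F, x ∈ hits k n) →
      (hits k n).ncard = (F.filter (· ∈ hits k n)).card := by
    intro n hn
    rw [← Set.ncard_coe_finset]
    congr 1
    ext x
    simp only [Finset.coe_filter, Set.mem_ofPred_eq]
    refine ⟨fun h => ⟨?_, h⟩, fun h => h.2⟩
    by_contra hx
    exact hn ⟨x, hx, h⟩
  let D : Finset ℕ := (Finset.range (N + 1)).filter fun n => ∃ x ∉ F, x ∈ hits k n
  -- Truncation to `F` is harmless unless `n` or `n + 1` is hit from outside `F`; `0` is added
  -- because `intervalSet` excludes it. As `n + 1` may equal `N`, `D` runs over `range (N + 1)`.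
  let C : Finset ℕ := {0} ∪ (D ∪ D.image fun n => n - 1)
  have hC : (C.card : ℝ) ≤
      1 + 2 * (N + 1) * ∑' x : {x : Lam k // x ∉ F}, 1 / ((x : Lam k) : ℝ) := by
    have h1 : C.card ≤ 1 + (D.card + D.card) := by
      refine (Finset.card_union_le _ _).trans ?_
      gcongr
      · simp
      · exact (Finset.card_union_le _ _).trans (Nat.add_le_add_left Finset.card_image_le _)
    have h2 : (C.card : ℝ) ≤ 1 + (D.card + D.card) := by exact_mod_cast h1
    have h3 := card_filter_exists_hits_le hk F (N + 1)
    push_cast at h3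
    change (D.card : ℝ) ≤ _ at h3
    linarith
  refine (abs_card_sub_card_le (C := C) fun n hn => ?_).trans hC
  simp only [C, D, Finset.mem_union, Finset.mem_singleton, Finset.mem_image, not_or,
    Finset.mem_filter, Finset.mem_range] at hn ⊢
  obtain ⟨hn0, hn1, hn2⟩ := hn
  refine and_congr_right fun hnN => ?_
  rw [mem_intervalSet_iff hk, hcard n fun h => hn1 ⟨by omega, h⟩,
    hcard (n + 1) fun h => hn2 ⟨n + 1, ⟨by omega, h⟩, by omega⟩]
  exact and_iff_right (by omega)

open scoped Classical in
theorem tendsto_count_intervalSet {k : ℕ} (hk : 2 ≤ k) (l m : ℕ) :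
    Tendsto (fun N : ℕ => (((Finset.range N).filter fun n => n ∈ intervalSet k l m).card : ℝ) / N)
      atTop (𝓝 (∑' U : Finset (Lam k), densityCoeff l m U.card * ∏ x ∈ U, 1 / (x : ℝ))) := by
  have hsum := summable_one_div_Lam hk
  have hw0 : ∀ x : Lam k, 0 ≤ 1 / (x : ℝ) := fun x => one_div_nonneg.2 (Lam_pos hk x).le
  have hD : Tendsto (fun F : Finset (Lam k) =>
      ∑ U ∈ F.powerset, densityCoeff l m U.card * ∏ x ∈ U, 1 / (x : ℝ)) atTop
      (𝓝 (∑' U : Finset (Lam k), densityCoeff l m U.card * ∏ x ∈ U, 1 / (x : ℝ))) :=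
    (summable_densityCoeff_mul_prod hsum hw0 l m).hasSum.comp
      tendsto_finset_powerset_atTop_atTop
  have htail := tendsto_tsum_compl_atTop_zero fun x : Lam k => 1 / (x : ℝ)
  rw [Metric.tendsto_atTop]
  intro ε hε
  -- With tail below `ε/16`, the error `1 + 2(N+1)T` is at most `ε N/4 + ε N/4` once `N ≥ 1` and `N
  -- > 4/ε`.
  obtain ⟨F, hF1, hF2⟩ := ((hD.eventually (Metric.ball_mem_nhds _ (by positivity : 0 < ε / 4))).and
    (htail.eventually (Metric.ball_mem_nhds _ (by positivity : 0 < ε / 16)))).exists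
  rw [dist_zero_right, Real.norm_eq_abs] at hF2
  obtain ⟨N₁, hN₁⟩ := Metric.tendsto_atTop.1 (tendsto_count_hits_card hk l m F) (ε / 4)
    (by positivity)
  obtain ⟨N₂, hN₂⟩ := exists_nat_gt (4 / ε)
  refine ⟨max N₁ (max N₂ 1), fun N hN => ?_⟩
  have hNN₁ : N₁ ≤ N := (le_max_left _ _).trans hN
  have hNN₂ : N₂ ≤ N := ((le_max_left _ _).trans (le_max_right _ _)).trans hN
  have hN1 : 1 ≤ N := ((le_max_right _ _).trans (le_max_right _ _)).trans hN
  have hNpos : (1 : ℝ) ≤ N := by exact_mod_cast hN1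
  have h1 := hN₁ N hNN₁
  have h2 := abs_count_sub_count_le hk l m F N
  set T := ∑' x : {x : Lam k // x ∉ F}, 1 / ((x : Lam k) : ℝ) with hT
  have hTlt : T < ε / 16 := (le_abs_self _).trans_lt hF2
  have h3 : 1 + 2 * (N + 1) * T ≤ (ε / 2) * N := by
    have h4 : 4 / ε < N := hN₂.trans_le (by exact_mod_cast hNN₂)
    rw [div_lt_iff₀ hε] at h4
    have h5 : 2 * ((N : ℝ) + 1) * T ≤ 2 * ((N : ℝ) + 1) * (ε / 16) := by gcongr
    nlinarith
  have h6 : dist ((((Finset.range N).filter fun n => n ∈ intervalSet k l m).card : ℝ) / N)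
      ((((Finset.range N).filter fun n => (F.filter (· ∈ hits k n)).card = l ∧
        (F.filter (· ∈ hits k (n + 1))).card = m).card : ℝ) / N) ≤ ε / 2 := by
    rw [Real.dist_eq, ← sub_div, abs_div, abs_of_pos (by linarith : (0 : ℝ) < N),
      div_le_iff₀ (by linarith)]
    exact h2.trans h3
  have h7 := dist_triangle4
    ((((Finset.range N).filter fun n => n ∈ intervalSet k l m).card : ℝ) / N)
    ((((Finset.range N).filter fun n => (F.filter (· ∈ hits k n)).card = l ∧
        (F.filter (· ∈ hits k (n + 1))).card = m).card : ℝ) / N)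
    (∑ U ∈ F.powerset, densityCoeff l m U.card * ∏ x ∈ U, 1 / (x : ℝ))
    (∑' U : Finset (Lam k), densityCoeff l m U.card * ∏ x ∈ U, 1 / (x : ℝ))
  linarith

-- The condition `n ≤ x` means `n < ⌊x⌋ + 1`, and `(⌊x⌋ + 1)/x → 1`.
open scoped Classical in
theorem hasAsymptoticDensity_of_tendsto_count {A : Set ℕ} {d : ℝ}
    (h : Tendsto (fun N : ℕ => (((Finset.range N).filter fun n => n ∈ A).card : ℝ) / N)
      atTop (𝓝 d)) : HasAsymptoticDensity A d := by
  have h1 : Tendsto (fun x : ℝ => ⌊x⌋₊ + 1) atTop atTop :=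
    (tendsto_add_atTop_nat 1).comp tendsto_nat_floor_atTop
  have h2 : Tendsto (fun x : ℝ => ((⌊x⌋₊ + 1 : ℕ) : ℝ) / x) atTop (𝓝 1) := by
    have h3 := (tendsto_nat_floor_div_atTop (R := ℝ)).add
      (tendsto_const_nhds (x := (1 : ℝ)).div_atTop tendsto_id)
    rw [add_zero] at h3
    refine h3.congr fun x => ?_
    push_cast
    rw [add_div]
    rfl
  have h4 := (h.comp h1).mul h2
  rw [mul_one] at h4
  refine h4.congr' ?_
  filter_upwards [eventually_ge_atTop 0] with x hx
  have hN : ((⌊x⌋₊ + 1 : ℕ) : ℝ) ≠ 0 := Nat.cast_ne_zero.2 (Nat.succ_ne_zero _)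
  simp only [Function.comp_apply]
  rw [div_mul_div_cancel₀ hN, ← Set.ncard_coe_finset]
  congr 3
  ext n
  simp only [Finset.coe_filter, Finset.mem_range, Set.mem_ofPred_eq, Nat.lt_succ_iff,
    Nat.le_floor_iff hx]
  exact and_comm

/-! ### The series for the density -/

theorem summable_xiTerm {k : ℕ} (hk : 2 ≤ k) (r : ℕ) : Summable (xiTerm k r) := by
  have h : Summable fun U : Finset (Lam k) => ∏ x ∈ U, 1 / (x : ℝ) :=
    summable_finsetProd_of_summable_norm (summable_one_div_Lam hk).norm
  exact h.subtype _

/-- Unconditional summability over finite subsets permits grouping them by cardinality. -/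
theorem hasSum_densityCoeff_mul_xi {k : ℕ} (hk : 2 ≤ k) (l m : ℕ) :
    HasSum (fun r => densityCoeff l m r * xi k r)
      (∑' U : Finset (Lam k), densityCoeff l m U.card * ∏ x ∈ U, 1 / (x : ℝ)) := by
  have h := (summable_densityCoeff_mul_prod (summable_one_div_Lam hk)
    (fun x => one_div_nonneg.2 (Lam_pos hk x).le) l m).hasSum
  rw [← (Equiv.sigmaFiberEquiv (Finset.card : Finset (Lam k) → ℕ)).hasSum_iff] at h
  refine h.sigma fun r => ?_
  refine ((summable_xiTerm hk r).hasSum.mul_left (densityCoeff l m r)).congr_fun ?_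
  rintro ⟨U, hU⟩
  simp [xiTerm, Equiv.sigmaFiberEquiv, hU]

theorem mainTheorem6 (k : ℕ) (hk : 2 ≤ k) (l m : ℕ) :
    (∀ r : ℕ, Summable (xiTerm k r)) ∧
    ∃ d : ℝ, HasAsymptoticDensity (intervalSet k l m) d ∧
      HasSum (fun n : ℕ => (-2 : ℝ) ^ n *
        (Nat.multinomial Finset.univ ![l, m, n] : ℝ) * xi k (l + m + n)) d := by
  refine ⟨summable_xiTerm hk, _,
    hasAsymptoticDensity_of_tendsto_count (tendsto_count_intervalSet hk l m), ?_⟩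
  have h := hasSum_densityCoeff_mul_xi hk l m
  -- The coefficients of degree below `l + m` vanish, so the series may start there.
  rw [← hasSum_nat_add_iff' (l + m), Finset.sum_eq_zero, sub_zero] at h
  · refine h.congr_fun fun n => ?_
    rw [← densityCoeff_add, add_comm n]
  · intro r hr
    rw [densityCoeff_eq_zero (Finset.mem_range.1 hr), zero_mul]
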